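/- \textbf{Setting.} Let $P\ge 2$, $d\ge1$, let $u,v\in\mathbb R^d$ be unit vectors and let $x_0=(x^{(1)},\dots,x^{(P)})\in(\mathbb R^d)^P$ be a random image with $x^{(1)}=\zeta u$, $x^{(2)}=(1-\zeta)v$, where $\zeta$ is a square-integrable real random variable that is neither almost surely $0$ nor almost surely $1$, and where $x^{(3)},\dots,x^{(P)}$ are arbitrary square-integrable random vectors (in particular they may be independent of $(x^{(1)},x^{(2)})$). Fix $\alpha_t>0$ and $0<\beta_t<1$, and let $x_t=\alpha_t x_0+\beta_t\epsilon$ with $\epsilon\sim N(0,I_{Pd})$ independent of $x_0$. For weights $w=(w^{(1)},\dots,w^{(P)})\in(\mathbb R^d)^P$ the score network acts patchwise by $s_w^{(p)}(x^{(p)})=\langle w^{(p)},x^{(p)}\rangle w^{(p)}-x^{(p)}/\beta_t^2$, and the DDPM loss is $$L(w)=\mathbb E\sum_{p=1}^P\|s_w^{(p)}(x_t^{(p)})-\epsilon^{(p)}\|^2 .$$ The rule statistic is $\psi_w(x)=\langle s_w^{(1)}(x^{(1)})+\beta_t^{-2}x^{(1)},u\rangle+\langle s_w^{(2)}(x^{(2)})+\beta_t^{-2}x^{(2)},v\rangle$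 (for the true score it equals $\alpha_t/\beta_t^2$ identically), and $$\mathcal E_{\rm mse}=\mathbb E\big(\psi_w(x_t)-\tfrac{\alpha_t}{\beta_t^2}\big)^2,\qquad \mathcal E_{\rm bias}=\Big|\mathbb E\psi_w(x_t)-\tfrac{\alpha_t}{\beta_t^2}\Big|,\qquad \mathcal E_{\rm variance}=\operatorname{Var}\psi_w(x_t).$$ Put $m_1=\mathbb E\zeta$, $m_2=\mathbb E\zeta^2$, and $$\rho(m)=\frac{\alpha_t^2\beta_t^{-2}m+1+\beta_t}{\alpha_t^2m+\beta_t^2},\qquad \rho_1=\rho(m_2)=\rho(\mathbb E\zeta^2),\qquad \rho_2=\rho(1-2m_1+m_2)=\rho(\mathbb E(1-\zeta)^2),$$ $$C_0=\Big|\alpha_t m_1\rho_1+\alpha_t(1-m_1)\rho_2-\frac{\alpha_t}{\beta_t^2}\Big|,\qquad C_1=\alpha_t^2(m_2-m_1^2)(\rho_1-\rho_2)^2+\beta_t^2(\rho_1^2+\rho_2^2).$$ \textbf{Theorem.} The constant $C_1$ is strictly positive. The constant $C_0$ vanishes only if $\alpha_t^2\big(\operatorname{Var}\zeta+m_1(1-m_1)\big)+\beta_t^2=0$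 (and it does vanish then); in particular $C_0>0$ whenever $0\le\mathbb E\zeta\le1$, for example if $\zeta\in[0,1]$. Moreover, for all $K,C$ and all $\delta>0$ there is $\eta_0>0$, depending only on $P,\alpha_t,\beta_t,K,C,\delta$ (and not on $d$ or on the data), such that the following holds whenever $\mathbb E\|x^{(p)}\|^2\le K$ for all $p$. If gradient descent $w_{k+1}=w_k-\eta\nabla L(w_k)$ with step size $0<\eta\le\eta_0$ is started at $w_0\sim N(0,\sigma_0^2I_{Pd})$ with $0<\sigma_0\le C d^{-1/2}$, then with probability at least $1-\delta$ the iterates converge to a stationary point $w$ of $L$ with $$\|w^{(1)}\|^2=\langle w^{(1)},u\rangle^2=\rho_1,\qquad \|w^{(2)}\|^2=\langle w^{(2)},v\rangle^2=\rho_2,$$ and at this point $$\mathcal E_{\rm mse}=\mathcal E_{\rm bias}^2+\mathcal E_{\rm variance},\qquad \mathcal E_{\rm bias}=C_0,\qquad \mathcal E_{\rm variance}=C_1>0 .$$ In particular $\psi_w(x_t)=\alpha_t/\beta_t^2$ does not hold almost surely: the learned model does not exactly recover the inter-feature rule. -/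

import Mathlib

open MeasureTheory ProbabilityTheory Filter Topology

noncomputable section

namespace DiffusionRule

/-- A single image patch: a vector of `ℝᵈ` with its Euclidean structure. -/
abbrev Patch (d : ℕ) : Type := EuclideanSpace ℝ (Fin d)

/-- An image made of `P` patches in `ℝᵈ`, i.e. the Euclidean space `ℝ^{Pd}`. The weights of the
score network, one vector per patch, live in the same space. -/
abbrev Img (P d : ℕ) : Type := PiLp 2 (fun _ : Fin P => Patch d)

/-- The clean image: the first patch is `ζ u`, the second one is `(1 - ζ) v`, and the remaining
`q` patches are the random vectors `y`. -/
def cleanImage {Ω : Type*} {q d : ℕ} (ζ : Ω → ℝ) (u v : Patch d) (y : Ω → Fin q → Patch d)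
    (ω : Ω) : Img (q + 2) d :=
  WithLp.toLp 2 (Fin.cons (ζ ω • u) (Fin.cons ((1 - ζ ω) • v) (y ω)))

/-- The forward process `x_t = α x_0 + β ε`. -/
def noisyImage {P d : ℕ} (α β : ℝ) (x ε : Img P d) : Img P d := α • x + β • ε

/-- The score network with linear activation and one neuron per patch:
on patch `p` it is `⟨w_p, x_p⟩ w_p - x_p / β²`. -/
def scoreNet {P d : ℕ} (β : ℝ) (W x : Img P d) : Img P d :=
  WithLp.toLp 2 (fun p => inner ℝ (W p) (x p) • W p - (1 / β ^ 2) • x p)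

/-- The joint law of the randomness `ω` of the data and of the standard Gaussian noise `ε`,
which is independent of the data. -/
def jointLaw {Ω : Type*} [MeasurableSpace Ω] (μ : Measure Ω) (P d : ℕ) :
    Measure (Ω × Img P d) :=
  μ.prod (stdGaussian (Img P d))

/-- The DDPM loss `L(W) = 𝔼 ‖s_W(x_t) - ε‖² = ∑ₚ 𝔼 ‖s_W(x_t)ₚ - εₚ‖²`. -/
def ddpmLoss {Ω : Type*} [MeasurableSpace Ω] {P d : ℕ} (μ : Measure Ω) (x₀ : Ω → Img P d)
    (α β : ℝ) (W : Img P d) : ℝ :=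
  ∫ z, ‖scoreNet β W (noisyImage α β (x₀ z.1) z.2) - z.2‖ ^ 2 ∂(jointLaw μ P d)

/-- `k` steps of gradient descent on `L` with step size `η`, started at `W₀`. -/
def gradDescent {P d : ℕ} (L : Img P d → ℝ) (η : ℝ) (W₀ : Img P d) (k : ℕ) : Img P d :=
  (fun W => W - η • gradient L W)^[k] W₀

/-- The Gaussian law `N(0, σ² I)` on the weights. -/
def gaussianInit (P d : ℕ) (σ : ℝ) : Measure (Img P d) :=
  (stdGaussian (Img P d)).map (fun W => σ • W)

/-- The rule statistic
`ψ(x) = ⟨s_W(x)₁ + x₁ / β², u⟩ + ⟨s_W(x)₂ + x₂ / β², v⟩`.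
With the true score of `x_t` in place of `s_W` it is identically `α / β²`. -/
def ruleStat {q d : ℕ} (β : ℝ) (u v : Patch d) (W x : Img (q + 2) d) : ℝ :=
  inner ℝ (scoreNet β W x 0 + (1 / β ^ 2) • x 0) u +
    inner ℝ (scoreNet β W x 1 + (1 / β ^ 2) • x 1) v

/-- The rule statistic at `x_t`, as a random variable of data and noise. -/
def noisyRuleStat {Ω : Type*} {q d : ℕ} (α β : ℝ) (u v : Patch d) (x₀ : Ω → Img (q + 2) d)
    (W : Img (q + 2) d) (z : Ω × Img (q + 2) d) : ℝ :=
  ruleStat β u v W (noisyImage α β (x₀ z.1) z.2)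

/-- The rule-respecting (mean square) error `𝔼 (ψ(x_t) - α / β²)²`. -/
def ruleMSE {Ω : Type*} [MeasurableSpace Ω] {q d : ℕ} (μ : Measure Ω) (α β : ℝ) (u v : Patch d)
    (x₀ : Ω → Img (q + 2) d) (W : Img (q + 2) d) : ℝ :=
  ∫ z, (noisyRuleStat α β u v x₀ W z - α / β ^ 2) ^ 2 ∂(jointLaw μ (q + 2) d)

/-- The bias part `|𝔼 ψ(x_t) - α / β²|` of the error. -/
def ruleBias {Ω : Type*} [MeasurableSpace Ω] {q d : ℕ} (μ : Measure Ω) (α β : ℝ) (u v : Patch d)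
    (x₀ : Ω → Img (q + 2) d) (W : Img (q + 2) d) : ℝ :=
  |∫ z, noisyRuleStat α β u v x₀ W z ∂(jointLaw μ (q + 2) d) - α / β ^ 2|

/-- The variance part `Var ψ(x_t)` of the error. -/
def ruleVariance {Ω : Type*} [MeasurableSpace Ω] {q d : ℕ} (μ : Measure Ω) (α β : ℝ)
    (u v : Patch d) (x₀ : Ω → Img (q + 2) d) (W : Img (q + 2) d) : ℝ :=
  variance (noisyRuleStat α β u v x₀ W) (jointLaw μ (q + 2) d)

/-- The squared norm of the learned weight of a patch `ξ e` (`‖e‖ = 1`) with `𝔼 ξ² = m`. -/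
def statSq (α β m : ℝ) : ℝ := (α ^ 2 / β ^ 2 * m + 1 + β) / (α ^ 2 * m + β ^ 2)

/-- The bias as a function of `m₁ = 𝔼 ζ`, `m₂ = 𝔼 ζ²`, `α`, `β`;
note that `𝔼 (1 - ζ)² = 1 - 2 m₁ + m₂`. -/
def biasConst (m₁ m₂ α β : ℝ) : ℝ :=
  |α * m₁ * statSq α β m₂ + α * (1 - m₁) * statSq α β (1 - 2 * m₁ + m₂) - α / β ^ 2|

/-- The variance as a function of `m₁ = 𝔼 ζ`, `m₂ = 𝔼 ζ²`, `α`, `β`;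
note that `Var ζ = m₂ - m₁²`. -/
def varConst (m₁ m₂ α β : ℝ) : ℝ :=
  α ^ 2 * (m₂ - m₁ ^ 2) * (statSq α β m₂ - statSq α β (1 - 2 * m₁ + m₂)) ^ 2 +
    β ^ 2 * (statSq α β m₂ ^ 2 + statSq α β (1 - 2 * m₁ + m₂) ^ 2)

end DiffusionRule


end

open DiffusionRule

/-! The loss decouples over patches. With `M` the second moment operator of the noisy patch,
expanding the square and using the independence and centering of the noise gives, up to a constant,
the quartic `⟨M w, w⟩ (‖w‖² - 2/β²) - 2β ‖w‖²` in the patch weight `w` (`ddpmLoss_eq`). Its gradient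
combines `M w` and `w`, so in an eigenbasis of `M` each gradient step multiplies the `i`-th
coordinate by `1 - 2η rᵢ`, where `rᵢ = μᵢ (‖w‖² - 2/β²) + ⟨M w, w⟩ - 2β`.

The dynamics then has three features. Near or outside the sphere `‖w‖² = 2/β²` all `rᵢ` are at least
`1 - β`, so the iterates eventually stay strictly inside it. There `rᵢ` decreases in `μᵢ`, so
relative to a top coordinate all coordinates with smaller eigenvalue die out geometrically
(`ModeDescent.tendsto_ratio`). What remains is a scalar recursion for the top coordinate
(`tendsto_scalar_recursion`), which forces `‖w‖² → 1/β² + β/μ_max`. This needs only a bounded start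
with nonzero top coordinate: Markov's inequality gives the first up to probability `δ`, absence of
Gaussian mass on hyperplanes the second almost surely.

For a patch `ξ u` the operator is `α² 𝔼ξ² u uᵀ + β²`, whose top eigenspace is the line of `u`, and
the limiting squared norm is `statSq`. Hence at the limit the rule statistic is affine in `ζ` plus
an independent centered Gaussian, and its mean and variance are explicit. The noise part alone keeps
the variance positive. -/

open DiffusionRule

/-! ### Scalar recursions -/

/-- A perturbed contraction of nonnegative reals whose perturbation vanishes tends to zero. -/
theorem tendsto_zero_of_contraction {a e : ℕ → ℝ} {q : ℝ} (hq0 : 0 ≤ q) (hq1 : q < 1)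
    (ha : ∀ k, 0 ≤ a k) (he : Tendsto e atTop (𝓝 0))
    (h : ∀ᶠ k in atTop, a (k + 1) ≤ q * a k + e k) : Tendsto a atTop (𝓝 0) := by
  refine Metric.tendsto_atTop.2 fun ε hε => ?_
  have hε' : 0 < (1 - q) * (ε / 2) := mul_pos (by linarith) (by linarith)
  obtain ⟨N, hN⟩ := eventually_atTop.1 (h.and (he.eventually_lt_const hε'))
  -- Once `e k < (1 - q) ε/2`, the excess of `a` over `ε/2` contracts by the factor `q`.
  have hgeo : ∀ k, a (N + k) - ε / 2 ≤ q ^ k * a N := by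
    intro k
    induction k with
    | zero => simp; linarith
    | succ k ih =>
      obtain ⟨h1, h2⟩ := hN (N + k) (by omega)
      have := mul_le_mul_of_nonneg_left ih hq0
      rw [← add_assoc, pow_succ']
      nlinarith
  have hlim : Tendsto (fun k : ℕ => q ^ k * a N) atTop (𝓝 0) := by
    simpa using (tendsto_pow_atTop_nhds_zero_of_lt_one hq0 hq1).mul_const (a N)
  obtain ⟨N', hN'⟩ := eventually_atTop.1 (hlim.eventually_lt_const (half_pos hε))
  refine ⟨N + N', fun k hk => ?_⟩
  obtain ⟨m, rfl⟩ := Nat.exists_eq_add_of_le (show N ≤ k by omega)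
  rw [Real.dist_eq, sub_zero, abs_of_nonneg (ha _)]
  have := hgeo m
  have := hN' m (by omega)
  linarith

/-- Convergence of the scalar recursion `z ↦ z (1 - 2 η (h z² - b))` with a convergent
coefficient `h`. -/
theorem tendsto_scalar_recursion {z h : ℕ → ℝ} {h' b η : ℝ} (hz0 : 0 < z 0) (hη : 0 < η)
    (hb : 0 < b) (hh' : 0 < h') (hh : ∀ k, 0 < h k) (hlim : Tendsto h atTop (𝓝 h'))
    (hz : ∀ k, z (k + 1) = z k * (1 - 2 * η * (h k * z k ^ 2 - b)))
    (hηb : η * b ≤ 1 / 8) (hηz : ∀ k, η * (h k * z k ^ 2) ≤ 1 / 8) :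
    Tendsto z atTop (𝓝 √(b / h')) := by
  obtain ⟨H, hH⟩ : ∃ H, ∀ k, h k ≤ H := by
    obtain ⟨H, hH⟩ := hlim.bddAbove_range
    exact ⟨H, fun k => hH ⟨k, rfl⟩⟩
  have hHpos : 0 < H := (hh 0).trans_le (hH 0)
  have hs0 : 0 < √(b / H) := Real.sqrt_pos.2 (div_pos hb hHpos)
  -- A uniform lower bound for `z`: where `h z² ≤ b` the sequence does not decrease, and otherwise
  -- `z ≥ √(b/H)` and one step costs at most the factor `3/4`, so half of `√(b/H)` is safe.
  set l : ℝ := min (z 0) (√(b / H) / 2) with hl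
  have hlpos : 0 < l := lt_min hz0 (by linarith)
  have hlow : ∀ k, l ≤ z k := by
    intro k
    induction k with
    | zero => exact min_le_left _ _
    | succ k ih =>
      have hzk : 0 < z k := hlpos.trans_le ih
      rw [hz k]
      rcases le_total (h k * z k ^ 2) b with hc | hc
      · have : 0 ≤ η * (b - h k * z k ^ 2) := mul_nonneg hη.le (by linarith)
        nlinarith
      · have h1 : √(b / H) ≤ z k := by
          refine Real.sqrt_le_iff.2 ⟨hzk.le, (div_le_iff₀ hHpos).2 ?_⟩
          nlinarith [hH k, sq_nonneg (z k)]
        have h2 : l ≤ √(b / H) / 2 := min_le_right _ _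
        have h3 := hηz k
        have h4 : 0 ≤ η * b := by positivity
        nlinarith
  have hzpos : ∀ k, 0 < z k := fun k => hlpos.trans_le (hlow k)
  set x : ℝ := √(b / h') with hx
  have hxpos : 0 < x := Real.sqrt_pos.2 (div_pos hb hh')
  have hxsq : h' * x ^ 2 = b := by
    rw [hx, Real.sq_sqrt (div_pos hb hh').le]; field_simp
  have hhalf : ∀ᶠ k in atTop, h' / 2 < h k := hlim.eventually_const_lt (by linarith)
  have hzb : ∀ᶠ k in atTop, η * (h' * z k ^ 2) ≤ 1 / 4 := by
    filter_upwards [hhalf] with k hk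
    have h1 := hηz k
    have : η * (h' / 2 * z k ^ 2) ≤ η * (h k * z k ^ 2) := by gcongr
    linarith
  have herr : Tendsto (fun k => 2 * η * |z k| ^ 3 * |h k - h'|) atTop (𝓝 0) := by
    have h1 : Tendsto (fun k => 2 * η * (max 1 (1 / (4 * η * h'))) ^ 3 * |h k - h'|) atTop
        (𝓝 0) := by
      have : Tendsto (fun k => |h k - h'|) atTop (𝓝 0) := by
        simpa using (hlim.sub_const h').abs
      simpa using this.const_mul (2 * η * (max 1 (1 / (4 * η * h'))) ^ 3)
    refine squeeze_zero' (Eventually.of_forall fun k => by positivity) ?_ h1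
    filter_upwards [hzb] with k hk
    have hk' : z k ^ 2 ≤ 1 / (4 * η * h') := by
      rw [le_div_iff₀ (by positivity)]; nlinarith
    have hk'' : |z k| ≤ max 1 (1 / (4 * η * h')) := by
      rw [abs_of_pos (hzpos k)]
      rcases le_total (z k) 1 with h2 | h2
      · exact le_max_of_le_left h2
      · exact le_max_of_le_right (by nlinarith)
    gcongr
  set q : ℝ := 1 - 2 * η * h' * l * x with hq
  have hqx : ∀ᶠ k in atTop, 0 ≤ 1 - 2 * η * h' * z k * (z k + x) ∧
      1 - 2 * η * h' * z k * (z k + x) ≤ q := by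
    filter_upwards [hzb] with k hk
    have h1 : η * h' * (z k * x) ≤ (η * (h' * z k ^ 2) + η * b) / 2 := by
      rw [← hxsq]
      have : 0 ≤ η * h' * (z k - x) ^ 2 := by positivity
      nlinarith
    have hll := hlow k
    have h2 : η * h' * (l * x) ≤ η * h' * (z k * x) := by gcongr
    have h3 : 0 ≤ η * h' * z k ^ 2 := by positivity
    constructor <;> nlinarith
  have hq0 : 0 ≤ q := by
    obtain ⟨k, hk⟩ := hqx.exists
    exact hk.1.trans hk.2
  have hq1 : q < 1 := by
    have : 0 < 2 * η * h' * l * x := by positivity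
    linarith
  rw [tendsto_iff_dist_tendsto_zero]
  refine tendsto_zero_of_contraction hq0 hq1 (fun _ => dist_nonneg) herr ?_
  filter_upwards [hqx] with k hk
  -- Since `b = h' x²`, the map with the limiting coefficient `h'` fixes `x`; the factor of `z - x`
  -- is at most `q < 1`, and replacing `h k` by `h'` costs the vanishing last term.
  have hid : z (k + 1) - x = (1 - 2 * η * h' * z k * (z k + x)) * (z k - x)
      - 2 * η * z k ^ 3 * (h k - h') := by
    rw [hz k]; linear_combination (-2 * η * z k) * hxsq
  rw [Real.dist_eq, Real.dist_eq, hid]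
  refine (abs_sub _ _).trans ?_
  rw [abs_mul, abs_of_nonneg hk.1, abs_mul, abs_mul, abs_pow, abs_of_pos (by positivity : 0 < 2 * η)]
  gcongr
  exact hk.2

/-! ### Gradient descent in eigencoordinates -/

section Modes

variable {ι : Type*} [Fintype ι]

/-- In an eigenbasis of the second moment matrix of a patch, with eigenvalues `mu`, gradient descent
multiplies the `i`-th coordinate of `w` by `1 - 2 η modeRate β mu w i`. -/
noncomputable def modeRate (β : ℝ) (mu w : ι → ℝ) (i : ι) : ℝ :=
  mu i * (∑ l, w l ^ 2 - 2 / β ^ 2) + ∑ l, mu l * w l ^ 2 - 2 * β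

/-- A bound for `|modeRate|` when `mu ≤ Λ` and `∑ w² ≤ R`. -/
noncomputable def rateBound (β Λ R : ℝ) : ℝ := Λ * (R + 2 / β ^ 2) + Λ * R + 2

/-- How far `∑ w²` may be below `2 / β²` such that all coordinates are still damped. -/
noncomputable def dampingGap (β Λ : ℝ) : ℝ := (1 - β) / (2 * Λ)

/-- The step size is small relative to `β`, the spectral bound `Λ` and the radius `R`. -/
structure SmallStep (β Λ R η : ℝ) : Prop where
  beta_pos : 0 < β
  beta_lt : β < 1
  le_spec : β ^ 2 ≤ Λ
  le_radius : 2 / β ^ 2 ≤ R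
  pos : 0 < η
  -- Keeps every factor `1 - 2η rᵢ` in `[3/4, 5/4]`, so no coordinate changes sign.
  rate : 8 * η * rateBound β Λ R ≤ 1
  -- One step raises `∑ w²` by at most `6η · rateBound · R`, hence by at most half the gap.
  gap : 12 * η * rateBound β Λ R * R ≤ dampingGap β Λ

theorem exists_smallStep {β Λ R : ℝ} (hβ : 0 < β) (hβ' : β < 1) (hΛ : β ^ 2 ≤ Λ)
    (hR : 2 / β ^ 2 ≤ R) : ∃ η₀, 0 < η₀ ∧ ∀ η, 0 < η → η ≤ η₀ → SmallStep β Λ R η := by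
  have hΛ0 : 0 < Λ := lt_of_lt_of_le (by positivity) hΛ
  have hR0 : 0 < R := lt_of_lt_of_le (by positivity) hR
  have hG : 0 < rateBound β Λ R := by unfold rateBound; positivity
  have hc : 0 < dampingGap β Λ := div_pos (by linarith) (by positivity)
  refine ⟨min (1 / (8 * rateBound β Λ R)) (dampingGap β Λ / (12 * rateBound β Λ R * R)),
    by positivity, fun η hη h => ⟨hβ, hβ', hΛ, hR, hη, ?_, ?_⟩⟩
  · have := h.trans (min_le_left _ _)
    rw [le_div_iff₀ (by positivity)] at this
    linarith
  · have := h.trans (min_le_right _ _)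
    rw [le_div_iff₀ (by positivity)] at this
    linarith

namespace SmallStep

variable {β Λ R η : ℝ} {mu w : ι → ℝ}

theorem spec_pos (hs : SmallStep β Λ R η) : 0 < Λ :=
  lt_of_lt_of_le (pow_pos hs.beta_pos 2) hs.le_spec

theorem gap_pos (hs : SmallStep β Λ R η) : 0 < dampingGap β Λ :=
  div_pos (by linarith [hs.beta_lt]) (by linarith [hs.spec_pos])

theorem gap_mul (hs : SmallStep β Λ R η) : dampingGap β Λ * (Λ + β ^ 2) ≤ 1 - β := by
  have h := hs.spec_pos
  have h1 : dampingGap β Λ * (2 * Λ) = 1 - β := by unfold dampingGap; field_simp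
  nlinarith [hs.gap_pos, hs.le_spec]

theorem weighted_le (hmu' : ∀ i, mu i ≤ Λ) : ∑ l, mu l * w l ^ 2 ≤ Λ * ∑ l, w l ^ 2 := by
  rw [Finset.mul_sum]
  exact Finset.sum_le_sum fun l _ => mul_le_mul_of_nonneg_right (hmu' l) (sq_nonneg _)

theorem le_weighted (hmu : ∀ i, β ^ 2 ≤ mu i) : β ^ 2 * ∑ l, w l ^ 2 ≤ ∑ l, mu l * w l ^ 2 := by
  rw [Finset.mul_sum]
  exact Finset.sum_le_sum fun l _ => mul_le_mul_of_nonneg_right (hmu l) (sq_nonneg _)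

theorem abs_rate_le (hs : SmallStep β Λ R η) (hmu : ∀ i, β ^ 2 ≤ mu i) (hmu' : ∀ i, mu i ≤ Λ)
    (hw : ∑ l, w l ^ 2 ≤ R) (i : ι) : |modeRate β mu w i| ≤ rateBound β Λ R := by
  have h0 : 0 ≤ ∑ l, w l ^ 2 := Finset.sum_nonneg fun l _ => sq_nonneg _
  have h1 := weighted_le (w := w) hmu'
  have h2 := le_weighted (w := w) hmu
  have hβ := hs.beta_pos
  have hΛ := hs.spec_pos
  have h3 : 0 ≤ β ^ 2 * ∑ l, w l ^ 2 := by positivity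
  have h4 : Λ * ∑ l, w l ^ 2 ≤ Λ * R := by gcongr
  have h5 : 0 < 2 / β ^ 2 := by positivity
  have hmi : 0 ≤ mu i := (pow_pos hβ 2).le.trans (hmu i)
  have h6 : |mu i * (∑ l, w l ^ 2 - 2 / β ^ 2)| ≤ Λ * (R + 2 / β ^ 2) := by
    rw [abs_mul, abs_of_nonneg hmi]
    refine mul_le_mul (hmu' i) ?_ (abs_nonneg _) hΛ.le
    rw [abs_le]
    constructor <;> linarith
  rw [abs_le] at h6 ⊢
  have hb := hs.beta_lt
  unfold modeRate rateBound
  constructor <;> nlinarith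

theorem factor_mem (hs : SmallStep β Λ R η) (hmu : ∀ i, β ^ 2 ≤ mu i) (hmu' : ∀ i, mu i ≤ Λ)
    (hw : ∑ l, w l ^ 2 ≤ R) (i : ι) : |2 * η * modeRate β mu w i| ≤ 1 / 4 := by
  rw [abs_mul, abs_of_pos (by linarith [hs.pos])]
  have := mul_le_mul_of_nonneg_left (hs.abs_rate_le hmu hmu' hw i) hs.pos.le
  linarith [hs.rate]

/-- One step of gradient descent, near and away from the sphere of radius² `2 / β²`. -/
theorem sq_sum_step (hs : SmallStep β Λ R η) (hmu : ∀ i, β ^ 2 ≤ mu i) (hmu' : ∀ i, mu i ≤ Λ)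
    (hw : ∑ l, w l ^ 2 ≤ R) :
    (2 / β ^ 2 - dampingGap β Λ ≤ ∑ l, w l ^ 2 →
      ∑ l, (w l * (1 - 2 * η * modeRate β mu w l)) ^ 2 ≤
        (1 - 2 * η * (1 - β)) * ∑ l, w l ^ 2) ∧
    (∑ l, w l ^ 2 ≤ 2 / β ^ 2 - dampingGap β Λ →
      ∑ l, (w l * (1 - 2 * η * modeRate β mu w l)) ^ 2 ≤ 2 / β ^ 2 - dampingGap β Λ / 2) := by
  have hη := hs.pos
  constructor
  · intro h
    rw [Finset.mul_sum]
    refine Finset.sum_le_sum fun l _ => ?_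
    rw [mul_pow, mul_comm]
    refine mul_le_mul_of_nonneg_right ?_ (sq_nonneg _)
    have h1 := abs_le.1 (hs.factor_mem hmu hmu' hw l)
    -- With `∑ w² ≥ 2/β² - gap` and `⟨M w, w⟩ ≥ β² ∑ w²`, the rate is at least `2 - 2β - gap · (μ +
    -- β²)`, and `gap_mul` bounds the last product by `1 - β`.
    have hr : 1 - β ≤ modeRate β mu w l := by
      have h2 := le_weighted (w := w) hmu
      have h3 := hs.gap_mul
      have hml : 0 ≤ mu l := (pow_pos hs.beta_pos 2).le.trans (hmu l)
      have h4 : mu l * (-dampingGap β Λ) ≤ mu l * (∑ l, w l ^ 2 - 2 / β ^ 2) :=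
        mul_le_mul_of_nonneg_left (by linarith) hml
      have h5 : mu l * dampingGap β Λ ≤ Λ * dampingGap β Λ :=
        mul_le_mul_of_nonneg_right (hmu' l) hs.gap_pos.le
      have h6 : β ^ 2 * (2 / β ^ 2 - dampingGap β Λ) ≤ β ^ 2 * ∑ l, w l ^ 2 :=
        mul_le_mul_of_nonneg_left h (sq_nonneg _)
      have h7 : β ^ 2 * (2 / β ^ 2) = 2 := by have := hs.beta_pos; field_simp
      unfold modeRate
      nlinarith
    have h8 : η * (1 - β) ≤ η * modeRate β mu w l := by gcongr
    have h9 : 0 ≤ η * (1 - β) := mul_nonneg hη.le (by linarith [hs.beta_lt])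
    nlinarith
  · intro h
    have hG := hs.gap
    have h0 : 0 ≤ ∑ l, w l ^ 2 := Finset.sum_nonneg fun l _ => sq_nonneg _
    have hG0 : 0 ≤ rateBound β Λ R := by
      by_contra hneg
      have h5 : 0 < 2 / β ^ 2 := by have := hs.beta_pos; positivity
      have h6 := hs.le_radius
      have h7 := hs.spec_pos
      have : 0 ≤ rateBound β Λ R := by unfold rateBound; have : 0 < R := by linarith
                                       positivity
      exact hneg this
    have h1 : ∑ l, (w l * (1 - 2 * η * modeRate β mu w l)) ^ 2 ≤
        (1 + 6 * η * rateBound β Λ R) * ∑ l, w l ^ 2 := by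
      rw [Finset.mul_sum]
      refine Finset.sum_le_sum fun l _ => ?_
      rw [mul_pow, mul_comm]
      refine mul_le_mul_of_nonneg_right ?_ (sq_nonneg _)
      have h1 := abs_le.1 (hs.factor_mem hmu hmu' hw l)
      have h2 : 2 * η * |modeRate β mu w l| ≤ 2 * η * rateBound β Λ R :=
        mul_le_mul_of_nonneg_left (hs.abs_rate_le hmu hmu' hw l) (by linarith)
      have h3 : -(2 * η * modeRate β mu w l) ≤ 2 * η * |modeRate β mu w l| := by
        have := neg_abs_le (modeRate β mu w l)
        nlinarith
      have h4 : 0 ≤ 2 * η * rateBound β Λ R := by positivity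
      nlinarith
    have h2 : 6 * η * rateBound β Λ R * ∑ l, w l ^ 2 ≤ 6 * η * rateBound β Λ R * R := by gcongr
    linarith

end SmallStep

/-- A sequence of coordinate vectors that evolves by gradient descent. -/
structure ModeDescent (β Λ R η : ℝ) (mu : ι → ℝ) (w : ℕ → ι → ℝ) : Prop where
  small : SmallStep β Λ R η
  le_mu : ∀ i, β ^ 2 ≤ mu i
  mu_le : ∀ i, mu i ≤ Λ
  step : ∀ k i, w (k + 1) i = w k i * (1 - 2 * η * modeRate β mu (w k) i)
  init : ∑ l, w 0 l ^ 2 ≤ R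

namespace ModeDescent

variable {β Λ R η : ℝ} {mu : ι → ℝ} {w : ℕ → ι → ℝ}

theorem sq_sum_succ (h : ModeDescent β Λ R η mu w) (k : ℕ) : ∑ l, w (k + 1) l ^ 2 =
    ∑ l, (w k l * (1 - 2 * η * modeRate β mu (w k) l)) ^ 2 := by
  simp_rw [h.step k]

theorem sq_sum_le (h : ModeDescent β Λ R η mu w) (k : ℕ) : ∑ l, w k l ^ 2 ≤ R := by
  induction k with
  | zero => exact h.init
  | succ k ih =>
    obtain ⟨h1, h2⟩ := h.small.sq_sum_step h.le_mu h.mu_le ih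
    rw [h.sq_sum_succ]
    have h0 : 0 ≤ ∑ l, w k l ^ 2 := Finset.sum_nonneg fun l _ => sq_nonneg _
    rcases le_total (2 / β ^ 2 - dampingGap β Λ) (∑ l, w k l ^ 2) with hc | hc
    · refine (h1 hc).trans (le_trans ?_ ih)
      have : 0 ≤ η * (1 - β) := mul_nonneg h.small.pos.le (by linarith [h.small.beta_lt])
      nlinarith
    · linarith [h2 hc, h.small.gap_pos, h.small.le_radius]

theorem factor_mem (h : ModeDescent β Λ R η mu w) (k : ℕ) (i : ι) :
    3 / 4 ≤ 1 - 2 * η * modeRate β mu (w k) i ∧ 1 - 2 * η * modeRate β mu (w k) i ≤ 5 / 4 := by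
  have := abs_le.1 (h.small.factor_mem h.le_mu h.mu_le (h.sq_sum_le k) i)
  constructor <;> linarith

/-- The squared norm eventually stays strictly below `2 / β²`. -/
theorem eventually_sq_sum_le (h : ModeDescent β Λ R η mu w) :
    ∀ᶠ k in atTop, ∑ l, w k l ^ 2 ≤ 2 / β ^ 2 - dampingGap β Λ / 2 := by
  have hβ := h.small.beta_pos
  have hη := h.small.pos
  have hg := h.small.gap_pos
  have hstep := fun k => h.small.sq_sum_step h.le_mu h.mu_le (h.sq_sum_le k)
  have hnn : ∀ k, 0 ≤ ∑ l, w k l ^ 2 := fun k => Finset.sum_nonneg fun l _ => sq_nonneg _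
  have hκ : 0 < η * (1 - β) := mul_pos hη (by linarith [h.small.beta_lt])
  have hB : 0 < 2 / β ^ 2 - dampingGap β Λ / 2 := by
    have h1 := h.small.gap_mul
    have h2 : dampingGap β Λ * β ^ 2 ≤ 1 - β := by nlinarith [h.small.spec_pos]
    have h3 : dampingGap β Λ ≤ (1 - β) / β ^ 2 := by rwa [le_div_iff₀ (by positivity)]
    have h4 : (1 - β) / β ^ 2 < 2 / β ^ 2 := by gcongr; linarith
    linarith
  -- If the norm never got below the threshold, every step would be a contraction and the norm would
  -- tend to zero.
  have hex : ∃ N, ∑ l, w N l ^ 2 ≤ 2 / β ^ 2 - dampingGap β Λ / 2 := by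
    by_contra! hcon
    have hq : ∀ k, ∑ l, w (k + 1) l ^ 2 ≤ (1 - 2 * η * (1 - β)) * ∑ l, w k l ^ 2 := fun k => by
      rw [h.sq_sum_succ]
      exact (hstep k).1 (by linarith [hcon k])
    have hq0 : 0 ≤ 1 - 2 * η * (1 - β) := by
      by_contra hneg
      have h1 := hq 0
      have h2 := hnn (0 + 1)
      have h3 := hcon 0
      nlinarith
    have hz : Tendsto (fun k => ∑ l, w k l ^ 2) atTop (𝓝 0) :=
      tendsto_zero_of_contraction (e := fun _ => 0) hq0 (by linarith) hnn tendsto_const_nhds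
        (Eventually.of_forall fun k => by simpa using hq k)
    obtain ⟨k, hk⟩ := (hz.eventually_lt_const hB).exists
    exact lt_asymm hk (hcon k)
  obtain ⟨N, hN⟩ := hex
  -- The region is invariant: its outer shell is contracted, and from deeper inside one step gains
  -- at most half the gap.
  refine eventually_atTop.2 ⟨N, fun k hk => ?_⟩
  induction k, hk using Nat.le_induction with
  | base => exact hN
  | succ k _ ih =>
    rw [h.sq_sum_succ]
    rcases le_total (2 / β ^ 2 - dampingGap β Λ) (∑ l, w k l ^ 2) with hc | hc
    · refine ((hstep k).1 hc).trans (le_trans ?_ ih)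
      nlinarith [hnn k]
    · exact (hstep k).2 hc

theorem div_init_pos (h : ModeDescent β Λ R η mu w) {j : ι} (hj : w 0 j ≠ 0) (k : ℕ) :
    0 < w k j / w 0 j := by
  induction k with
  | zero => rw [div_self hj]; exact one_pos
  | succ k ih =>
    rw [h.step, mul_div_right_comm]
    exact mul_pos ih (by linarith [(h.factor_mem k j).1])

/-- Relative to a coordinate of maximal eigenvalue, the coordinates with this eigenvalue do not
move and the other ones vanish in the limit. -/
theorem tendsto_ratio (h : ModeDescent β Λ R η mu w) {j : ι} (hj : w 0 j ≠ 0)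
    (hmax : ∀ i, mu i ≤ mu j) (i : ι) :
    Tendsto (fun k => w k i / (w k j / w 0 j)) atTop
      (𝓝 (if mu i = mu j then w 0 i else 0)) := by
  have hpos := h.div_init_pos hj
  split_ifs with hij
  · have : ∀ k, w k i / (w k j / w 0 j) = w 0 i := by
      intro k
      induction k with
      | zero => rw [div_self hj, div_one]
      | succ k ih =>
        have hr : modeRate β mu (w k) i = modeRate β mu (w k) j := by
          unfold modeRate; rw [hij]
        have hf : 1 - 2 * η * modeRate β mu (w k) j ≠ 0 := by
          have := (h.factor_mem k j).1
          intro h0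
          linarith
        rw [h.step, h.step, hr, ← ih, mul_div_right_comm (w k j), mul_div_mul_right _ _ hf]
    simp_rw [this]
    exact tendsto_const_nhds
  · have hgap : 0 < mu j - mu i := sub_pos.2 (lt_of_le_of_ne (hmax i) hij)
    have hη := h.small.pos
    have hc := h.small.gap_pos
    -- The factors of `j` and `i` eventually differ by at least `θ`; as the factor of `j` is at most
    -- `5/4`, their ratio is at most `1 - θ/2`.
    set θ : ℝ := η * (mu j - mu i) * dampingGap β Λ with hθ
    have hθ0 : 0 < θ := by positivity
    have key : ∀ᶠ k in atTop, |1 - 2 * η * modeRate β mu (w k) i| ≤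
        (1 - θ / 2) * (1 - 2 * η * modeRate β mu (w k) j) := by
      filter_upwards [h.eventually_sq_sum_le] with k hk
      have h1 := h.factor_mem k i
      have h2 := h.factor_mem k j
      rw [abs_of_nonneg (by linarith)]
      have h3 : modeRate β mu (w k) i - modeRate β mu (w k) j =
          (mu j - mu i) * (2 / β ^ 2 - ∑ l, w k l ^ 2) := by unfold modeRate; ring
      have h4 : η * ((mu j - mu i) * (dampingGap β Λ / 2)) ≤
          η * ((mu j - mu i) * (2 / β ^ 2 - ∑ l, w k l ^ 2)) := by
        gcongr
        linarith
      rw [← h3] at h4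
      nlinarith
    have hq0 : 0 ≤ 1 - θ / 2 := by
      obtain ⟨k, hk⟩ := key.exists
      by_contra hneg
      have h2 := h.factor_mem k j
      have h3 := (abs_nonneg _).trans hk
      nlinarith
    rw [tendsto_zero_iff_abs_tendsto_zero]
    refine tendsto_zero_of_contraction (e := fun _ => 0) hq0 (by linarith) (fun _ => abs_nonneg _)
      tendsto_const_nhds ?_
    filter_upwards [key] with k hk
    have h2 := h.factor_mem k j
    have hf : 0 < 1 - 2 * η * modeRate β mu (w k) j := by linarith
    simp only [Function.comp_apply, add_zero]
    have hz := hpos k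
    rw [h.step, h.step, mul_div_right_comm (w k j), abs_div, abs_mul, abs_div (w k i),
      abs_of_pos (mul_pos hz hf), abs_of_pos hz, mul_div_mul_comm, mul_comm]
    gcongr
    exact (div_le_iff₀ hf).2 hk

/-- Gradient descent converges to a multiple of the projection of the initial vector to the top
eigenspace. -/
theorem exists_tendsto (h : ModeDescent β Λ R η mu w) {j : ι} (hj : w 0 j ≠ 0)
    (hmax : ∀ i, mu i ≤ mu j) :
    ∃ w' : ι → ℝ, (∀ i, Tendsto (fun k => w k i) atTop (𝓝 (w' i))) ∧
      (∀ i, mu i ≠ mu j → w' i = 0) ∧ ∑ i, w' i ^ 2 = 1 / β ^ 2 + β / mu j := by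
  have hβ := h.small.beta_pos
  have hη := h.small.pos
  set z : ℕ → ℝ := fun k => w k j / w 0 j with hz
  set a : ι → ℝ := fun i => if mu i = mu j then w 0 i else 0 with ha
  have hpos : ∀ k, 0 < z k := h.div_init_pos hj
  have hratio : ∀ i, Tendsto (fun k => w k i / z k) atTop (𝓝 (a i)) := h.tendsto_ratio hj hmax
  have hmupos : ∀ i, 0 < mu i := fun i => (pow_pos hβ 2).trans_le (h.le_mu i)
  have haj : a j = w 0 j := by simp [ha]
  set b : ℝ := 2 * (mu j / β ^ 2 + β) with hb
  have hb0 : 0 < b := by have := hmupos j; positivity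
  set S : ℝ := ∑ i, a i ^ 2 with hS
  have hS0 : 0 < S := by
    refine lt_of_lt_of_le (b := a j ^ 2) (by rw [haj]; positivity) ?_
    exact Finset.single_le_sum (f := fun i => a i ^ 2) (fun i _ => sq_nonneg _) (Finset.mem_univ j)
  -- Chosen so that the rate of coordinate `j` is `H k * z k ^ 2 - b`: this closes the recursion for
  -- `z`, with a coefficient that depends only on the convergent ratios.
  set H : ℕ → ℝ := fun k => ∑ i, (mu j + mu i) * (w k i / z k) ^ 2 with hH
  have hHlim : Tendsto H atTop (𝓝 (2 * mu j * S)) := by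
    have h1 : 2 * mu j * S = ∑ i, (mu j + mu i) * a i ^ 2 := by
      rw [hS, Finset.mul_sum]
      refine Finset.sum_congr rfl fun i _ => ?_
      by_cases hi : mu i = mu j
      · rw [hi]; ring
      · simp [ha, hi]
    rw [h1]
    exact tendsto_finsetSum _ fun i _ => ((hratio i).pow 2).const_mul _
  have hHpos : ∀ k, 0 < H k := fun k => by
    have h1 : (w k j / z k) ^ 2 ≠ 0 := by
      have : w k j ≠ 0 := by
        intro h0
        have := hpos k
        simp [hz, h0] at this
      have := (hpos k).ne'
      positivity
    refine lt_of_lt_of_le (b := (mu j + mu j) * (w k j / z k) ^ 2) ?_ ?_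
    · have := hmupos j
      positivity
    · exact Finset.single_le_sum (f := fun i => (mu j + mu i) * (w k i / z k) ^ 2)
        (fun i _ => mul_nonneg (add_nonneg (hmupos j).le (hmupos i).le) (sq_nonneg _))
        (Finset.mem_univ j)
  have hHz : ∀ k, H k * z k ^ 2 = mu j * ∑ l, w k l ^ 2 + ∑ l, mu l * w k l ^ 2 := fun k => by
    have := (hpos k).ne'
    rw [hH, Finset.sum_mul, Finset.mul_sum, ← Finset.sum_add_distrib]
    refine Finset.sum_congr rfl fun i _ => ?_
    field_simp
  have hrate : ∀ k, modeRate β mu (w k) j = H k * z k ^ 2 - b := fun k => by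
    rw [hHz, hb, modeRate]; ring
  have hGb : b ≤ rateBound β Λ R := by
    have h1 : mu j / β ^ 2 ≤ Λ / β ^ 2 := by gcongr; exact h.mu_le j
    have h2 : 0 < Λ := h.small.spec_pos
    have h3 : 0 < 2 / β ^ 2 := by positivity
    have h4 : 0 ≤ Λ * R := mul_nonneg h2.le (h3.le.trans h.small.le_radius)
    have h5 : Λ * (2 / β ^ 2) = 2 * (Λ / β ^ 2) := by ring
    rw [hb, rateBound, mul_add Λ, h5]
    linarith [h.small.beta_lt]
  have hGz : ∀ k, H k * z k ^ 2 ≤ rateBound β Λ R := fun k => by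
    have h1 := h.sq_sum_le k
    have h2 := SmallStep.weighted_le (w := w k) h.mu_le
    have h0 : 0 ≤ ∑ l, w k l ^ 2 := Finset.sum_nonneg fun l _ => sq_nonneg _
    have hΛ := h.small.spec_pos
    have h3 : mu j * ∑ l, w k l ^ 2 ≤ Λ * R := by
      have := h.mu_le j
      gcongr
    have h4 : Λ * ∑ l, w k l ^ 2 ≤ Λ * R := by gcongr
    have h5 : 0 < Λ * (2 / β ^ 2) := by positivity
    rw [hHz, rateBound, mul_add Λ]
    linarith
  have hzlim : Tendsto z atTop (𝓝 √(b / (2 * mu j * S))) := by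
    refine tendsto_scalar_recursion (h := H) (hpos 0) hη hb0 (by have := hmupos j; positivity)
      hHpos hHlim (fun k => ?_) ?_ (fun k => ?_)
    · simp only [hz]
      rw [h.step, hrate, mul_div_right_comm]
    · have := mul_le_mul_of_nonneg_left hGb hη.le
      linarith [h.small.rate]
    · have := mul_le_mul_of_nonneg_left (hGz k) hη.le
      linarith [h.small.rate]
  refine ⟨fun i => √(b / (2 * mu j * S)) * a i, fun i => ?_, fun i hi => ?_, ?_⟩
  · refine (hzlim.mul (hratio i)).congr fun k => ?_
    exact mul_div_cancel₀ _ (hpos k).ne'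
  · simp [ha, hi]
  · have hm := hmupos j
    simp_rw [mul_pow]
    rw [← Finset.mul_sum, ← hS, Real.sq_sqrt (by positivity), hb]
    field_simp

end ModeDescent

end Modes

/-! ### The loss of one patch -/

section PatchOperator

variable {E : Type*} [NormedAddCommGroup E] [InnerProductSpace ℝ E]

/-- The part of the loss that depends on the weight `w` of a patch whose noisy second moment
operator is `M`. -/
noncomputable def patchLoss (β : ℝ) (M : E →L[ℝ] E) (w : E) : ℝ :=
  inner ℝ (M w) w * (‖w‖ ^ 2 - 2 / β ^ 2) - 2 * β * ‖w‖ ^ 2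

/-- The gradient of `patchLoss`. -/
noncomputable def patchGrad (β : ℝ) (M : E →L[ℝ] E) (w : E) : E :=
  (2 : ℝ) • ((‖w‖ ^ 2 - 2 / β ^ 2) • M w + (inner ℝ (M w) w - 2 * β) • w)

theorem hasFDerivAt_patchLoss (β : ℝ) {M : E →L[ℝ] E} (hM : M.toLinearMap.IsSymmetric) (w : E) :
    HasFDerivAt (patchLoss β M) (innerSL ℝ (patchGrad β M w)) w := by
  have hn : HasFDerivAt (fun w : E => ‖w‖ ^ 2) (2 • innerSL ℝ w) w :=
    (hasStrictFDerivAt_norm_sq w).hasFDerivAt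
  have hq := M.hasFDerivAt (x := w) |>.inner ℝ (hasFDerivAt_id w)
  refine ((hq.mul (hn.sub_const (2 / β ^ 2))).sub (hn.const_mul (2 * β))).congr_fderiv ?_
  ext v
  have hs : inner ℝ (M v) w = inner ℝ (M w) v := by
    rw [real_inner_comm]; exact (hM w v).symm
  simp [patchGrad, fderivInnerCLM_apply, hs]
  ring

/-- On an eigenvector the gradient is radial, with coefficient proportional to `l ‖w‖² - l/β² - β`;
the prescribed norm is its zero. -/
theorem patchGrad_eq_zero {β l : ℝ} {M : E →L[ℝ] E} {w : E} (hβ : β ≠ 0) (hl : l ≠ 0)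
    (hMw : M w = l • w) (hw : ‖w‖ ^ 2 = 1 / β ^ 2 + β / l) : patchGrad β M w = 0 := by
  have h : (‖w‖ ^ 2 - 2 / β ^ 2) * l + (l * ‖w‖ ^ 2 - 2 * β) = 0 := by
    rw [hw]; field_simp; ring
  rw [patchGrad, hMw, inner_smul_left, real_inner_self_eq_norm_sq, smul_smul, ← add_smul]
  simp only [conj_trivial]
  rw [h, zero_smul, smul_zero]

variable [FiniteDimensional ℝ E] [Nontrivial E]

/-- There is a hyperplane such that gradient descent on `patchLoss`, started off this hyperplane,
converges to an eigenvector of `M` for its largest eigenvalue. -/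
theorem exists_tendsto_iterate_patchGrad {β Λ : ℝ} {M : E →L[ℝ] E}
    (hM : M.toLinearMap.IsSymmetric) (hlow : ∀ x, β ^ 2 * ‖x‖ ^ 2 ≤ inner ℝ (M x) x)
    (hup : ∀ x, inner ℝ (M x) x ≤ Λ * ‖x‖ ^ 2) :
    ∃ e : E, e ≠ 0 ∧ ∀ (R η : ℝ) (w₀ : E), SmallStep β Λ R η → ‖w₀‖ ^ 2 ≤ R →
      inner ℝ e w₀ ≠ 0 → ∃ (l : ℝ) (w : E),
        Tendsto (fun k => (fun w => w - η • patchGrad β M w)^[k] w₀) atTop (𝓝 w) ∧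
        M w = l • w ∧ ‖w‖ ^ 2 = 1 / β ^ 2 + β / l ∧ ∀ x, inner ℝ (M x) x ≤ l * ‖x‖ ^ 2 := by
  set b := hM.eigenvectorBasis rfl with hb
  set mu := hM.eigenvalues rfl with hmu
  have hbM : ∀ i, M (b i) = mu i • b i := fun i => hM.apply_eigenvectorBasis rfl i
  have hcoord : ∀ i x, inner ℝ (b i) (M x) = mu i * inner ℝ (b i) x := fun i x => by
    have : inner ℝ (b i) (M x) = inner ℝ (M (b i)) x := (hM (b i) x).symm
    rw [this, hbM, inner_smul_left, conj_trivial]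
  have hsq : ∀ x, ∑ i, inner ℝ (b i) x ^ 2 = ‖x‖ ^ 2 := fun x => b.sum_sq_inner_right x
  have hquad : ∀ x, ∑ i, mu i * inner ℝ (b i) x ^ 2 = inner ℝ (M x) x := fun x => by
    rw [← b.sum_inner_mul_inner]
    refine Finset.sum_congr rfl fun i _ => ?_
    rw [real_inner_comm (b i) (M x), hcoord]; ring
  have hself : ∀ i, inner ℝ (M (b i)) (b i) = mu i := fun i => by
    rw [hbM, inner_smul_left, real_inner_self_eq_norm_sq, b.norm_eq_one]; simp
  have hlow' : ∀ i, β ^ 2 ≤ mu i := fun i => by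
    simpa [hself, b.norm_eq_one] using hlow (b i)
  have hup' : ∀ i, mu i ≤ Λ := fun i => by
    simpa [hself, b.norm_eq_one] using hup (b i)
  -- The eigenvalues are sorted in decreasing order, so index `0` is a top one; the hyperplane is
  -- the orthogonal complement of its eigenvector.
  let j : Fin (Module.finrank ℝ E) := ⟨0, Module.finrank_pos⟩
  have hmax : ∀ i, mu i ≤ mu j := fun i =>
    hM.eigenvalues_antitone rfl (Fin.mk_le_of_le_val (Nat.zero_le _))
  refine ⟨b j, b.orthonormal.ne_zero j, fun R η w₀ hs hR hj => ?_⟩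
  set W : ℕ → E := fun k => (fun w => w - η • patchGrad β M w)^[k] w₀ with hW
  have hdesc : ModeDescent β Λ R η mu (fun k i => inner ℝ (b i) (W k)) := by
    refine ⟨hs, hlow', hup', fun k i => ?_, ?_⟩
    · have : W (k + 1) = W k - η • patchGrad β M (W k) := Function.iterate_succ_apply' _ _ _
      simp only [this, modeRate, hsq, hquad, patchGrad, inner_sub_right, inner_smul_right,
        inner_add_right, hcoord]
      ring
    · rw [hsq]; exact hR
  obtain ⟨c, hc, hc0, hcs⟩ := hdesc.exists_tendsto hj hmax
  have hlim : Tendsto W atTop (𝓝 (∑ i, c i • b i)) := by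
    have h1 : Tendsto (fun k => ∑ i, inner ℝ (b i) (W k) • b i) atTop (𝓝 (∑ i, c i • b i)) :=
      tendsto_finsetSum _ fun i _ => (hc i).smul_const _
    exact h1.congr fun k => b.sum_repr' (W k)
  have hin : ∀ i, inner ℝ (b i) (∑ i, c i • b i) = c i := fun i =>
    b.orthonormal.inner_right_fintype c i
  refine ⟨mu j, _, hlim, ?_, ?_, fun x => ?_⟩
  · rw [map_sum, Finset.smul_sum]
    refine Finset.sum_congr rfl fun i _ => ?_
    by_cases hi : mu i = mu j
    · rw [map_smul, hbM, hi, smul_comm]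
    · simp [hc0 i hi]
  · rw [← hcs, ← hsq]
    simp_rw [hin]
  · rw [← hquad, ← hsq, Finset.mul_sum]
    exact Finset.sum_le_sum fun i _ => mul_le_mul_of_nonneg_right (hmax i) (sq_nonneg _)

end PatchOperator

/-! ### Standard Gaussian measures -/

section StdGaussian

variable {E : Type*} [NormedAddCommGroup E] [InnerProductSpace ℝ E] [FiniteDimensional ℝ E]
  [MeasurableSpace E] [BorelSpace E]

theorem memLp_inner_stdGaussian (h : E) : MemLp (fun x => inner ℝ h x) 2 (stdGaussian E) :=
  IsGaussian.memLp_dual _ (innerSL ℝ h) 2 (by simp)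

theorem integral_inner_stdGaussian (h : E) : ∫ x, inner ℝ h x ∂(stdGaussian E) = 0 :=
  integral_strongDual_stdGaussian (innerSL ℝ h)

theorem variance_inner_stdGaussian (h : E) :
    variance (fun x => inner ℝ h x) (stdGaussian E) = ‖h‖ ^ 2 := by
  have := variance_dual_stdGaussian (innerSL ℝ h)
  rwa [innerSL_apply_norm] at this

theorem integral_inner_sq_stdGaussian (h : E) :
    ∫ x, inner ℝ h x ^ 2 ∂(stdGaussian E) = ‖h‖ ^ 2 := by
  rw [← variance_inner_stdGaussian, variance_of_integral_eq_zero
    (memLp_inner_stdGaussian h).1.aemeasurable (integral_inner_stdGaussian h)]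

theorem integral_norm_sq_stdGaussian :
    ∫ x, ‖x‖ ^ 2 ∂(stdGaussian E) = Module.finrank ℝ E := by
  have h : ∀ x : E, ‖x‖ ^ 2 = ∑ i, inner ℝ (stdOrthonormalBasis ℝ E i) x ^ 2 := fun x =>
    ((stdOrthonormalBasis ℝ E).sum_sq_inner_right x).symm
  simp_rw [h]
  rw [integral_finsetSum _ fun i _ => (memLp_inner_stdGaussian _).integrable_sq]
  simp [integral_inner_sq_stdGaussian, (stdOrthonormalBasis ℝ E).norm_eq_one]

/-- The functional `⟨h, ·⟩` has a Gaussian law of variance `‖h‖² > 0`, which has no atoms. -/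
theorem stdGaussian_hyperplane {h : E} (hh : h ≠ 0) :
    stdGaussian E {x | inner ℝ h x = 0} = 0 := by
  have hmap := IsGaussian.map_eq_gaussianReal (μ := stdGaussian E) (innerSL ℝ h)
  rw [variance_dual_stdGaussian, integral_strongDual_stdGaussian, innerSL_apply_norm] at hmap
  have hv : (‖h‖ ^ 2).toNNReal ≠ 0 := (Real.toNNReal_pos.2 (by positivity)).ne'
  have := nullSingletonClass_gaussianReal (μ := 0) hv
  have h0 : (stdGaussian E).map (innerSL ℝ h) {0} = 0 := by rw [hmap]; exact measure_singleton 0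
  rwa [Measure.map_apply (by fun_prop) (measurableSet_singleton 0)] at h0

end StdGaussian

/-! ### The random initial weights -/

section GaussianInit

variable {P d : ℕ}

theorem inner_piLp_single (p : Fin P) (w : Patch d) (x : Img P d) :
    inner ℝ (PiLp.single 2 p w : Img P d) x = inner ℝ w (x p) := by
  rw [PiLp.inner_apply, Finset.sum_eq_single p]
  · simp
  · intro b _ hb
    simp [hb]
  · simp

theorem gaussianInit_hyperplane {σ : ℝ} (hσ : σ ≠ 0) (p : Fin P) {e : Patch d} (he : e ≠ 0) :
    gaussianInit P d σ {W | inner ℝ e (W p) = 0} = 0 := by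
  have hne : (PiLp.single 2 p e : Img P d) ≠ 0 := by simpa using he
  have hms : MeasurableSet {W : Img P d | inner ℝ e (W p) = 0} :=
    (isClosed_eq (by fun_prop) continuous_const).measurableSet
  rw [gaussianInit, Measure.map_apply (by fun_prop) hms]
  convert stdGaussian_hyperplane hne using 2
  ext W
  simp [inner_piLp_single, inner_smul_right, hσ]

/-- Markov's inequality for `‖W‖²`, whose mean is `σ² P d`. -/
theorem gaussianInit_norm_sq_ge {σ R δ : ℝ} (hR : 0 < R) (h : σ ^ 2 * (P * d) ≤ δ * R) :
    gaussianInit P d σ {W | R ≤ ‖W‖ ^ 2} ≤ ENNReal.ofReal δ := by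
  have hms : MeasurableSet {W : Img P d | R ≤ ‖W‖ ^ 2} :=
    (isClosed_le continuous_const (by fun_prop)).measurableSet
  have hint : Integrable (fun W : Img P d => ‖σ • W‖ ^ 2) (stdGaussian (Img P d)) :=
    (memLp_two_iff_integrable_sq_norm (by fun_prop)).1
      ((IsGaussian.memLp_two_id (μ := stdGaussian (Img P d))).const_smul σ)
  have hmk := mul_meas_ge_le_integral_of_nonneg (Eventually.of_forall fun W => sq_nonneg ‖σ • W‖)
    hint R
  have hval : ∫ W : Img P d, ‖σ • W‖ ^ 2 ∂(stdGaussian (Img P d)) = σ ^ 2 * (P * d) := by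
    simp_rw [norm_smul, mul_pow, Real.norm_eq_abs, sq_abs]
    rw [integral_const_mul, integral_norm_sq_stdGaussian]
    rw [(WithLp.linearEquiv 2 ℝ (Fin P → Patch d)).finrank_eq, Module.finrank_pi_fintype]
    simp
  rw [hval] at hmk
  rw [gaussianInit, Measure.map_apply (by fun_prop) hms, ← ofReal_measureReal]
  refine ENNReal.ofReal_le_ofReal ?_
  have : R * (stdGaussian (Img P d)).real {W | R ≤ ‖σ • W‖ ^ 2} ≤ R * δ := by linarith
  exact le_of_mul_le_mul_left this hR

end GaussianInit

/-! ### The loss and its gradient -/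

section Loss

variable {Ω : Type*} [MeasurableSpace Ω] {P d : ℕ}

/-- The second moment operator of the noisy patch `α x + β ε`. -/
noncomputable def noisyMoment (μ : Measure Ω) (α β : ℝ) (x : Ω → Patch d) : Patch d →L[ℝ] Patch d :=
  α ^ 2 • covarianceOperator (μ.map x) + β ^ 2 • ContinuousLinearMap.id ℝ (Patch d)

variable {μ : Measure Ω} {α β : ℝ}

/-- `covarianceOperator` is not centered, so it yields second moments without subtracting the mean.
-/
theorem covarianceOperator_map_inner {x : Ω → Patch d} (hx : MemLp x 2 μ) (v w : Patch d) :
    inner ℝ (covarianceOperator (μ.map x) v) w = ∫ ω, inner ℝ v (x ω) * inner ℝ w (x ω) ∂μ := by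
  rw [covarianceOperator_inner
    ((memLp_map_measure_iff (by fun_prop) hx.1.aemeasurable).2 hx),
    integral_map hx.1.aemeasurable (by fun_prop)]

theorem noisyMoment_inner {x : Ω → Patch d} (hx : MemLp x 2 μ) (w : Patch d) :
    inner ℝ (noisyMoment μ α β x w) w =
      α ^ 2 * ∫ ω, inner ℝ w (x ω) ^ 2 ∂μ + β ^ 2 * ‖w‖ ^ 2 := by
  simp only [noisyMoment, add_apply, smul_apply,
    ContinuousLinearMap.id_apply, inner_add_left, inner_smul_left, conj_trivial,
    covarianceOperator_map_inner hx, real_inner_self_eq_norm_sq, sq (inner ℝ w _)]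

theorem noisyMoment_isSymmetric (μ : Measure Ω) (α β : ℝ) (x : Ω → Patch d) :
    (noisyMoment μ α β x).toLinearMap.IsSymmetric := by
  intro v w
  have := (isPositive_covarianceOperator (μ := μ.map x)).isSymmetric v w
  simp only [ContinuousLinearMap.coe_coe] at this
  simp [noisyMoment, inner_add_left, inner_add_right, inner_smul_left, inner_smul_right, this]

theorem le_noisyMoment_inner {x : Ω → Patch d} (hx : MemLp x 2 μ) (w : Patch d) :
    β ^ 2 * ‖w‖ ^ 2 ≤ inner ℝ (noisyMoment μ α β x w) w := by
  rw [noisyMoment_inner hx]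
  have : 0 ≤ ∫ ω, inner ℝ w (x ω) ^ 2 ∂μ := integral_nonneg fun _ => sq_nonneg _
  have : 0 ≤ α ^ 2 * ∫ ω, inner ℝ w (x ω) ^ 2 ∂μ := by positivity
  linarith

theorem noisyMoment_inner_le {x : Ω → Patch d} (hx : MemLp x 2 μ) {K : ℝ}
    (hK : ∫ ω, ‖x ω‖ ^ 2 ∂μ ≤ K) (w : Patch d) :
    inner ℝ (noisyMoment μ α β x w) w ≤ (α ^ 2 * K + β ^ 2) * ‖w‖ ^ 2 := by
  rw [noisyMoment_inner hx]
  have h1 : ∫ ω, inner ℝ w (x ω) ^ 2 ∂μ ≤ ∫ ω, ‖w‖ ^ 2 * ‖x ω‖ ^ 2 ∂μ := by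
    refine integral_mono (hx.const_inner w).integrable_sq
      (((memLp_two_iff_integrable_sq_norm hx.1).1 hx).const_mul _) fun ω => ?_
    simp only
    rw [← mul_pow, ← sq_abs]
    exact pow_le_pow_left₀ (abs_nonneg _) (abs_real_inner_le_norm _ _) 2
  rw [integral_const_mul] at h1
  have h2 : ∫ ω, inner ℝ w (x ω) ^ 2 ∂μ ≤ ‖w‖ ^ 2 * K := h1.trans (by gcongr)
  have h3 : α ^ 2 * ∫ ω, inner ℝ w (x ω) ^ 2 ∂μ ≤ α ^ 2 * (‖w‖ ^ 2 * K) := by gcongr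
  linarith

variable [IsProbabilityMeasure μ] {x₀ : Ω → Img P d}

theorem integral_data {E : Type*} [NormedAddCommGroup E] [NormedSpace ℝ E]
    (μ : Measure Ω) [IsProbabilityMeasure μ] (f : Ω → E) :
    ∫ z, f z.1 ∂(jointLaw μ P d) = ∫ ω, f ω ∂μ := by
  rw [jointLaw, integral_fun_fst]; simp

theorem integral_noise {E : Type*} [NormedAddCommGroup E] [NormedSpace ℝ E]
    (μ : Measure Ω) [IsProbabilityMeasure μ] (f : Img P d → E) :
    ∫ z, f z.2 ∂(jointLaw μ P d) = ∫ x, f x ∂(stdGaussian (Img P d)) := by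
  rw [jointLaw, integral_fun_snd]; simp

instance (μ : Measure Ω) [IsProbabilityMeasure μ] : IsProbabilityMeasure (jointLaw μ P d) := by
  unfold jointLaw; infer_instance

theorem memLp_noise (μ : Measure Ω) [IsProbabilityMeasure μ] (p : Fin P) :
    MemLp (fun z : Ω × Img P d => z.2 p) 2 (jointLaw μ P d) := by
  have h : MemLp (fun x : Img P d => x p) 2 (stdGaussian (Img P d)) :=
    (PiLp.proj 2 (fun _ : Fin P => Patch d) p : Img P d →L[ℝ] Patch d).comp_memLp'
      IsGaussian.memLp_two_id
  exact h.comp_snd μ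

/-- Sorted by what integration does: two squares, a cross term of mean zero, and a remainder that
does not involve `w`. -/
theorem norm_sq_patch_error (α β : ℝ) (w x g : Patch d) :
    ‖inner ℝ w (α • x + β • g) • w - (1 / β ^ 2) • (α • x + β • g) - g‖ ^ 2 =
      α ^ 2 * (‖w‖ ^ 2 - 2 / β ^ 2) * inner ℝ w x ^ 2 +
        (β ^ 2 * (‖w‖ ^ 2 - 2 / β ^ 2) - 2 * β) * inner ℝ w g ^ 2 +
        (2 * α * β * (‖w‖ ^ 2 - 2 / β ^ 2) - 2 * α) * (inner ℝ w x * inner ℝ w g) +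
        ‖(1 / β ^ 2) • (α • x + β • g) + g‖ ^ 2 := by
  have h2 : inner ℝ w (α • x + β • g) = α * inner ℝ w x + β * inner ℝ w g := by
    simp [inner_add_right, inner_smul_right]
  rw [sub_sub, norm_sub_sq_real, norm_smul, mul_pow, Real.norm_eq_abs, sq_abs, inner_smul_left,
    h2, inner_add_right w ((1 / β ^ 2) • (α • x + β • g)) g, inner_smul_right, h2, conj_trivial]
  ring

theorem integral_norm_sq_error {Ω' : Type*} [MeasurableSpace Ω'] {ν : Measure Ω'}
    {x g : Ω' → Patch d} (hx : MemLp x 2 ν) (hg : MemLp g 2 ν) (w : Patch d)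
    (hgg : ∫ z, inner ℝ w (g z) ^ 2 ∂ν = ‖w‖ ^ 2)
    (hxg : ∫ z, inner ℝ w (x z) * inner ℝ w (g z) ∂ν = 0) :
    Integrable (fun z => ‖inner ℝ w (α • x z + β • g z) • w -
      (1 / β ^ 2) • (α • x z + β • g z) - g z‖ ^ 2) ν ∧
    ∫ z, ‖inner ℝ w (α • x z + β • g z) • w - (1 / β ^ 2) • (α • x z + β • g z) - g z‖ ^ 2 ∂ν =
      (α ^ 2 * ∫ z, inner ℝ w (x z) ^ 2 ∂ν + β ^ 2 * ‖w‖ ^ 2) * (‖w‖ ^ 2 - 2 / β ^ 2) -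
        2 * β * ‖w‖ ^ 2 + ∫ z, ‖(1 / β ^ 2) • (α • x z + β • g z) + g z‖ ^ 2 ∂ν := by
  have hF : MemLp (fun z => inner ℝ w (x z)) 2 ν := hx.const_inner w
  have hG : MemLp (fun z => inner ℝ w (g z)) 2 ν := hg.const_inner w
  have hY : MemLp (fun z => α • x z + β • g z) 2 ν := (hx.const_smul α).add (hg.const_smul β)
  have hcY : ∀ c : ℝ, MemLp (fun z => c • (α • x z + β • g z)) 2 ν := fun c => hY.const_smul c
  have hX : MemLp (fun z => (1 / β ^ 2) • (α • x z + β • g z) + g z) 2 ν := (hcY _).add hg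
  have hiFG : Integrable (fun z => inner ℝ w (x z) * inner ℝ w (g z)) ν := hF.integrable_mul hG
  have hiX := (memLp_two_iff_integrable_sq_norm hX.1).1 hX
  simp_rw [norm_sq_patch_error]
  have h1 := hF.integrable_sq.const_mul (α ^ 2 * (‖w‖ ^ 2 - 2 / β ^ 2))
  have h2 := hG.integrable_sq.const_mul (β ^ 2 * (‖w‖ ^ 2 - 2 / β ^ 2) - 2 * β)
  have h3 := hiFG.const_mul (2 * α * β * (‖w‖ ^ 2 - 2 / β ^ 2) - 2 * α)
  have h12 := h1.fun_add h2
  have h123 := h12.fun_add h3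
  refine ⟨h123.fun_add hiX, ?_⟩
  rw [integral_add h123 hiX, integral_add h12 h3, integral_add h1 h2,
    integral_const_mul, integral_const_mul, integral_const_mul, hxg, hgg]
  ring

/-- The contribution of one patch to the DDPM loss. -/
theorem integral_norm_sq_patch_error (p : Fin P) {x : Ω → Patch d} (hx : MemLp x 2 μ)
    (w : Patch d) :
    Integrable (fun z : Ω × Img P d => ‖inner ℝ w (α • x z.1 + β • z.2 p) • w -
      (1 / β ^ 2) • (α • x z.1 + β • z.2 p) - z.2 p‖ ^ 2) (jointLaw μ P d) ∧
    ∫ z, ‖inner ℝ w (α • x z.1 + β • z.2 p) • w -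
      (1 / β ^ 2) • (α • x z.1 + β • z.2 p) - z.2 p‖ ^ 2 ∂(jointLaw μ P d) =
      patchLoss β (noisyMoment μ α β x) w +
        ∫ z, ‖(1 / β ^ 2) • (α • x z.1 + β • z.2 p) + z.2 p‖ ^ 2 ∂(jointLaw μ P d) := by
  have hF2 : ∫ z, inner ℝ w (x z.1) ^ 2 ∂(jointLaw μ P d) = ∫ ω, inner ℝ w (x ω) ^ 2 ∂μ :=
    integral_data μ fun ω => inner ℝ w (x ω) ^ 2
  have hG2 : ∫ z, inner ℝ w (z.2 p) ^ 2 ∂(jointLaw μ P d) = ‖w‖ ^ 2 := by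
    rw [integral_noise μ fun x : Img P d => inner ℝ w (x p) ^ 2]
    simp_rw [← inner_piLp_single]
    rw [integral_inner_sq_stdGaussian, PiLp.norm_single]
  have hFG : ∫ z, inner ℝ w (x z.1) * inner ℝ w (z.2 p) ∂(jointLaw μ P d) = 0 := by
    rw [jointLaw, integral_prod_mul (fun ω => inner ℝ w (x ω))
      (fun x : Img P d => inner ℝ w (x p))]
    simp_rw [← inner_piLp_single p w]
    rw [integral_inner_stdGaussian, mul_zero]
  rw [patchLoss, noisyMoment_inner hx, ← hF2]
  exact integral_norm_sq_error (hx.comp_fst (stdGaussian (Img P d))) (memLp_noise μ p) w hG2 hFG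

/-- The DDPM loss is a sum over the patches of explicit quartic polynomials. -/
theorem ddpmLoss_eq (hx : ∀ p, MemLp (fun ω => x₀ ω p) 2 μ) (W : Img P d) :
    ddpmLoss μ x₀ α β W = ∑ p, patchLoss β (noisyMoment μ α β fun ω => x₀ ω p) (W p) +
      ∑ p, ∫ z, ‖(1 / β ^ 2) • (α • x₀ z.1 p + β • z.2 p) + z.2 p‖ ^ 2 ∂(jointLaw μ P d) := by
  have hpoint : ∀ z : Ω × Img P d, ‖scoreNet β W (noisyImage α β (x₀ z.1) z.2) - z.2‖ ^ 2 =
      ∑ p, ‖inner ℝ (W p) (α • x₀ z.1 p + β • z.2 p) • W p -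
        (1 / β ^ 2) • (α • x₀ z.1 p + β • z.2 p) - z.2 p‖ ^ 2 := fun z => by
    rw [PiLp.norm_sq_eq_of_L2]
    rfl
  have hpatch := fun p => integral_norm_sq_patch_error (P := P) (α := α) (β := β) p (hx p) (W p)
  unfold ddpmLoss
  simp_rw [hpoint]
  rw [integral_finsetSum _ fun p _ => (hpatch p).1, ← Finset.sum_add_distrib]
  exact Finset.sum_congr rfl fun p _ => (hpatch p).2

theorem hasGradientAt_ddpmLoss (hx : ∀ p, MemLp (fun ω => x₀ ω p) 2 μ)
    (W : Img P d) : HasGradientAt (ddpmLoss μ x₀ α β)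
      (WithLp.toLp 2 fun p => patchGrad β (noisyMoment μ α β fun ω => x₀ ω p) (W p)) W := by
  rw [funext (ddpmLoss_eq (α := α) (β := β) hx), hasGradientAt_iff_hasFDerivAt]
  refine (HasFDerivAt.add_const _ (HasFDerivAt.fun_sum fun p _ =>
    (hasFDerivAt_patchLoss β (noisyMoment_isSymmetric μ α β fun ω => x₀ ω p) (W p)).comp W
      (PiLp.proj 2 (fun _ : Fin P => Patch d) p : _ →L[ℝ] _).hasFDerivAt)).congr_fderiv ?_
  ext V
  simp [PiLp.inner_apply]

theorem gradDescent_ddpmLoss (hx : ∀ p, MemLp (fun ω => x₀ ω p) 2 μ)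
    (η : ℝ) (W : Img P d) (k : ℕ) (p : Fin P) : gradDescent (ddpmLoss μ x₀ α β) η W k p =
      (fun w => w - η • patchGrad β (noisyMoment μ α β fun ω => x₀ ω p) w)^[k] (W p) := by
  induction k with
  | zero => rfl
  | succ k ih =>
    rw [Function.iterate_succ_apply', ← ih, gradDescent, Function.iterate_succ_apply',
      (hasGradientAt_ddpmLoss hx _).gradient]
    simp [gradDescent]

end Loss

/-! ### Patches in a fixed direction -/

section RankOne

variable {Ω : Type*} [MeasurableSpace Ω] {μ : Measure Ω} {d : ℕ} {α β : ℝ}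

theorem memLp_smul_vector {ξ : Ω → ℝ} (hξ : MemLp ξ 2 μ) (u : Patch d) :
    MemLp (fun ω => ξ ω • u) 2 μ :=
  (ContinuousLinearMap.toSpanSingleton ℝ u).comp_memLp' hξ

theorem noisyMoment_smul_const {ξ : Ω → ℝ} (hξ : MemLp ξ 2 μ) (u w : Patch d) :
    noisyMoment μ α β (fun ω => ξ ω • u) w =
      (α ^ 2 * (∫ ω, ξ ω ^ 2 ∂μ) * inner ℝ u w) • u + β ^ 2 • w := by
  have hx := memLp_smul_vector hξ u
  refine ext_inner_right ℝ fun y => ?_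
  have h : ∀ ω, inner ℝ w (ξ ω • u) * inner ℝ y (ξ ω • u) =
      inner ℝ u w * inner ℝ u y * ξ ω ^ 2 := fun ω => by
    rw [inner_smul_right, inner_smul_right, real_inner_comm u w, real_inner_comm u y]; ring
  simp only [noisyMoment, add_apply, smul_apply,
    ContinuousLinearMap.id_apply, inner_add_left, inner_smul_left, conj_trivial,
    covarianceOperator_map_inner hx, h, integral_const_mul]
  ring

/-- For a patch in a fixed direction `u`, a top eigenvector of the noisy second moment operator with
the norm of a stationary point is `±√(statSq) u`. -/
theorem exists_eq_smul_of_top_eigenvector (hα : 0 < α) (hβ : 0 < β) {ξ : Ω → ℝ}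
    (hξ : MemLp ξ 2 μ) {u : Patch d} (hu : ‖u‖ = 1) (hm : 0 < ∫ ω, ξ ω ^ 2 ∂μ) {l : ℝ}
    {w : Patch d} (hw : noisyMoment μ α β (fun ω => ξ ω • u) w = l • w)
    (hn : ‖w‖ ^ 2 = 1 / β ^ 2 + β / l)
    (hl : ∀ x, inner ℝ (noisyMoment μ α β (fun ω => ξ ω • u) x) x ≤ l * ‖x‖ ^ 2) :
    ∃ c : ℝ, w = c • u ∧ c ^ 2 = statSq α β (∫ ω, ξ ω ^ 2 ∂μ) := by
  set m : ℝ := ∫ ω, ξ ω ^ 2 ∂μ with hmdef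
  have huu : inner ℝ u u = (1 : ℝ) := by rw [real_inner_self_eq_norm_sq, hu]; norm_num
  -- Testing with `u` gives `l ≥ α² m + β² > β²`, so the eigenvalue equation puts `w` on the line of
  -- `u`.
  have hlu := hl u
  rw [noisyMoment_smul_const hξ, inner_add_left, inner_smul_left, inner_smul_left, huu, hu,
    ← hmdef] at hlu
  simp only [conj_trivial, mul_one, one_pow] at hlu
  have hαm : 0 < α ^ 2 * m := by positivity
  have hl0 : 0 < l := by nlinarith [sq_nonneg β]
  have hlβ : l - β ^ 2 ≠ 0 := by linarith
  have hw0 : w ≠ 0 := by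
    rintro rfl
    have : 0 < 1 / β ^ 2 + β / l := by positivity
    simp at hn
    simp at this
    linarith
  rw [noisyMoment_smul_const hξ, ← hmdef] at hw
  obtain ⟨c, rfl⟩ : ∃ c : ℝ, w = c • u := by
    refine ⟨(l - β ^ 2)⁻¹ * (α ^ 2 * m * inner ℝ u w), ?_⟩
    rw [mul_smul, eq_inv_smul_iff₀ hlβ, sub_smul, ← hw, add_sub_cancel_right]
  have hu0 : u ≠ 0 := right_ne_zero_of_smul hw0
  have hc0 : c ≠ 0 := left_ne_zero_of_smul hw0
  rw [inner_smul_right, huu, smul_smul, smul_smul, ← add_smul] at hw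
  have hl' : l = α ^ 2 * m + β ^ 2 := by
    have := smul_left_injective ℝ hu0 hw
    have h2 : c * (α ^ 2 * m + β ^ 2) = c * l := by linarith
    exact (mul_left_cancel₀ hc0 h2).symm
  refine ⟨c, rfl, ?_⟩
  rw [norm_smul, hu, mul_one, Real.norm_eq_abs, sq_abs] at hn
  rw [hn, statSq, hl']
  rw [hl'] at hl0
  field_simp

theorem integral_sq_pos {ξ : Ω → ℝ} (hξ : MemLp ξ 2 μ) (h : ¬ ∀ᵐ ω ∂μ, ξ ω = 0) :
    0 < ∫ ω, ξ ω ^ 2 ∂μ := by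
  refine lt_of_le_of_ne (integral_nonneg fun _ => sq_nonneg _) fun h0 => h ?_
  have := (integral_eq_zero_iff_of_nonneg (fun _ => sq_nonneg _) hξ.integrable_sq).1 h0.symm
  filter_upwards [this] with ω hω
  simpa using hω

end RankOne

/-! ### The bias and variance constants -/

section Constants

variable {α β : ℝ}

theorem statSq_eq (hβ : β ≠ 0) {m : ℝ} (hm : α ^ 2 * m + β ^ 2 ≠ 0) :
    statSq α β m = 1 / β ^ 2 + β / (α ^ 2 * m + β ^ 2) := by
  unfold statSq
  field_simp

theorem statSq_pos (hβ : 0 < β) {m : ℝ} (hm : 0 ≤ m) : 0 < statSq α β m := by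
  unfold statSq
  positivity

theorem varConst_pos (hβ : 0 < β) {m₁ m₂ : ℝ} (hm₂ : 0 ≤ m₂) (hvar : m₁ ^ 2 ≤ m₂)
    (hm : 0 ≤ 1 - 2 * m₁ + m₂) : 0 < varConst m₁ m₂ α β := by
  have h1 := statSq_pos (α := α) hβ hm₂
  have h2 := statSq_pos (α := α) hβ hm
  have h3 : 0 ≤ m₂ - m₁ ^ 2 := sub_nonneg.2 hvar
  unfold varConst
  positivity

/-- The `1/β²` parts of the two `statSq` values add up to exactly the target `α/β²`; what survives
is `αβ (m₁/D₁ + (1 - m₁)/D₂)`, with `D₁`, `D₂` the top eigenvalues. -/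
theorem biasConst_eq (hβ : 0 < β) {m₁ m₂ : ℝ} (hm₂ : 0 ≤ m₂) (hm : 0 ≤ 1 - 2 * m₁ + m₂) :
    biasConst m₁ m₂ α β = |α * β * (α ^ 2 * (m₂ - m₁ ^ 2 + m₁ * (1 - m₁)) + β ^ 2) /
      ((α ^ 2 * m₂ + β ^ 2) * (α ^ 2 * (1 - 2 * m₁ + m₂) + β ^ 2))| := by
  have h1 : 0 < α ^ 2 * m₂ + β ^ 2 := by positivity
  have h2 : 0 < α ^ 2 * (1 - 2 * m₁ + m₂) + β ^ 2 := by positivity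
  rw [biasConst, statSq_eq hβ.ne' h1.ne', statSq_eq hβ.ne' h2.ne']
  congr 1
  have hsum : m₁ * (α ^ 2 * (1 - 2 * m₁ + m₂) + β ^ 2) + (1 - m₁) * (α ^ 2 * m₂ + β ^ 2) =
      α ^ 2 * (m₂ - m₁ ^ 2 + m₁ * (1 - m₁)) + β ^ 2 := by ring
  rw [← hsum]
  generalize α ^ 2 * m₂ + β ^ 2 = D₁ at h1
  generalize α ^ 2 * (1 - 2 * m₁ + m₂) + β ^ 2 = D₂ at h2
  field_simp
  ring

theorem biasConst_eq_zero_iff (hα : 0 < α) (hβ : 0 < β) {m₁ m₂ : ℝ} (hm₂ : 0 ≤ m₂)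
    (hm : 0 ≤ 1 - 2 * m₁ + m₂) :
    biasConst m₁ m₂ α β = 0 ↔ α ^ 2 * (m₂ - m₁ ^ 2 + m₁ * (1 - m₁)) + β ^ 2 = 0 := by
  have h1 : 0 < α ^ 2 * m₂ + β ^ 2 := by positivity
  have h2 : 0 < α ^ 2 * (1 - 2 * m₁ + m₂) + β ^ 2 := by positivity
  rw [biasConst_eq hβ hm₂ hm, abs_eq_zero, div_eq_zero_iff, mul_eq_zero]
  have : α * β ≠ 0 := by positivity
  have := (mul_pos h1 h2).ne'
  tauto

end Constants

/-! ### The rule statistic at the limit -/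

section RuleStat

variable {Ω : Type*} {q d : ℕ} {α β : ℝ}

theorem cleanImage_zero (ζ : Ω → ℝ) (u v : Patch d) (y : Ω → Fin q → Patch d) (ω : Ω) :
    cleanImage ζ u v y ω 0 = ζ ω • u := rfl

theorem cleanImage_one (ζ : Ω → ℝ) (u v : Patch d) (y : Ω → Fin q → Patch d) (ω : Ω) :
    cleanImage ζ u v y ω 1 = (1 - ζ ω) • v := rfl

/-- At a stationary point of gradient descent the rule statistic is an affine function of `ζ` plus a
linear functional of the noise. -/
theorem noisyRuleStat_eq {ζ : Ω → ℝ} {u v : Patch d} (hu : ‖u‖ = 1) (hv : ‖v‖ = 1)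
    (y : Ω → Fin q → Patch d) {W : Img (q + 2) d} {c₁ c₂ : ℝ} (h0 : W 0 = c₁ • u)
    (h1 : W 1 = c₂ • v) (z : Ω × Img (q + 2) d) :
    noisyRuleStat α β u v (cleanImage ζ u v y) W z =
      (α * (c₁ ^ 2 - c₂ ^ 2) * ζ z.1 + α * c₂ ^ 2) +
        inner ℝ (PiLp.single 2 0 ((β * c₁ ^ 2) • u) + PiLp.single 2 1 ((β * c₂ ^ 2) • v) :
          Img (q + 2) d) z.2 := by
  have huu : inner ℝ u u = (1 : ℝ) := by rw [real_inner_self_eq_norm_sq, hu]; norm_num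
  have hvv : inner ℝ v v = (1 : ℝ) := by rw [real_inner_self_eq_norm_sq, hv]; norm_num
  rw [inner_add_left, inner_piLp_single, inner_piLp_single]
  simp only [noisyRuleStat, ruleStat, scoreNet, noisyImage, h0, h1, PiLp.add_apply, PiLp.smul_apply,
    cleanImage_zero, cleanImage_one, sub_add_cancel, inner_smul_left, inner_smul_right,
    inner_add_right, conj_trivial, huu, hvv]
  ring

theorem norm_sq_add_single (a b : Patch d) :
    ‖(PiLp.single 2 0 a + PiLp.single 2 1 b : Img (q + 2) d)‖ ^ 2 = ‖a‖ ^ 2 + ‖b‖ ^ 2 := by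
  rw [norm_add_sq_real, inner_piLp_single, PiLp.norm_single, PiLp.norm_single]
  simp

variable [MeasurableSpace Ω] {μ : Measure Ω} [IsProbabilityMeasure μ] {P : ℕ}

theorem memLp_cleanImage {ζ : Ω → ℝ} (hζ : MemLp ζ 2 μ)
    {y : Ω → Fin q → Patch d} (hy : ∀ j, MemLp (fun ω => y ω j) 2 μ) (u v : Patch d)
    (p : Fin (q + 2)) : MemLp (fun ω => cleanImage ζ u v y ω p) 2 μ := by
  refine Fin.cases ?_ (fun p => Fin.cases ?_ (fun j => ?_) p) p
  · exact memLp_smul_vector hζ u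
  · exact memLp_smul_vector ((memLp_const 1).sub hζ) v
  · exact hy j

/-- Moments of an affine function of the data plus a linear functional of the noise. -/
theorem moments_affine_add_noise {ζ : Ω → ℝ} (hζ : MemLp ζ 2 μ) (a b : ℝ) (h : Img P d) :
    MemLp (fun z : Ω × Img P d => (a * ζ z.1 + b) + inner ℝ h z.2) 2 (jointLaw μ P d) ∧
    ∫ z, ((a * ζ z.1 + b) + inner ℝ h z.2) ∂(jointLaw μ P d) = a * ∫ ω, ζ ω ∂μ + b ∧
    variance (fun z : Ω × Img P d => (a * ζ z.1 + b) + inner ℝ h z.2) (jointLaw μ P d) =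
      a ^ 2 * variance ζ μ + ‖h‖ ^ 2 := by
  have hf : MemLp (fun ω => a * ζ ω + b) 2 μ := (hζ.const_mul a).add (memLp_const b)
  have hX : MemLp (fun z : Ω × Img P d => a * ζ z.1 + b) 2 (jointLaw μ P d) := hf.comp_fst _
  have hY : MemLp (fun z : Ω × Img P d => inner ℝ h z.2) 2 (jointLaw μ P d) :=
    (memLp_inner_stdGaussian h).comp_snd μ
  refine ⟨hX.add hY, ?_, ?_⟩
  · rw [integral_add (hX.integrable one_le_two) (hY.integrable one_le_two),
      integral_data μ fun ω => a * ζ ω + b, integral_noise μ fun x : Img P d => inner ℝ h x,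
      integral_inner_stdGaussian, integral_add ((hζ.integrable one_le_two).const_mul a)
        (integrable_const b), integral_const_mul]
    simp
  · rw [jointLaw, variance_add_prod (X := fun ω => a * ζ ω + b) hf (memLp_inner_stdGaussian h),
      variance_inner_stdGaussian, variance_add_const (hζ.1.const_mul a), variance_const_mul]

theorem integral_sub_const_sq {Ω' : Type*} [MeasurableSpace Ω'] {ν : Measure Ω'}
    [IsProbabilityMeasure ν] {f : Ω' → ℝ} (hf : MemLp f 2 ν) (c : ℝ) :
    ∫ z, (f z - c) ^ 2 ∂ν = |∫ z, f z ∂ν - c| ^ 2 + variance f ν := by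
  have h := variance_eq_sub (hf.sub (memLp_const c))
  have h' : variance (f - fun _ => c) ν = variance f ν := variance_sub_const hf.1 c
  have h1 : ∫ z, (f z - c) ∂ν = ∫ z, f z ∂ν - c := by
    rw [integral_sub (hf.integrable one_le_two) (integrable_const c)]; simp
  rw [h'] at h
  simp only [Pi.pow_apply, Pi.sub_apply, h1] at h
  rw [sq_abs, h]
  ring

theorem rule_errors {ζ : Ω → ℝ} (hζ : MemLp ζ 2 μ) {u v : Patch d} (hu : ‖u‖ = 1) (hv : ‖v‖ = 1)
    (y : Ω → Fin q → Patch d) {W : Img (q + 2) d} {c₁ c₂ m₁ m₂ : ℝ} (h0 : W 0 = c₁ • u)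
    (h1 : W 1 = c₂ • v) (hm₁ : m₁ = ∫ ω, ζ ω ∂μ) (hm₂ : m₂ = ∫ ω, ζ ω ^ 2 ∂μ)
    (hc₁ : c₁ ^ 2 = statSq α β m₂) (hc₂ : c₂ ^ 2 = statSq α β (1 - 2 * m₁ + m₂)) :
    MemLp (noisyRuleStat α β u v (cleanImage ζ u v y) W) 2 (jointLaw μ (q + 2) d) ∧
    ruleMSE μ α β u v (cleanImage ζ u v y) W =
      ruleBias μ α β u v (cleanImage ζ u v y) W ^ 2 +
        ruleVariance μ α β u v (cleanImage ζ u v y) W ∧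
    ruleBias μ α β u v (cleanImage ζ u v y) W = biasConst m₁ m₂ α β ∧
    ruleVariance μ α β u v (cleanImage ζ u v y) W = varConst m₁ m₂ α β := by
  obtain ⟨hL, hI, hV⟩ := moments_affine_add_noise hζ (α * (c₁ ^ 2 - c₂ ^ 2)) (α * c₂ ^ 2)
    (PiLp.single 2 0 ((β * c₁ ^ 2) • u) + PiLp.single 2 1 ((β * c₂ ^ 2) • v) : Img (q + 2) d)
  have heq : noisyRuleStat α β u v (cleanImage ζ u v y) W = _ :=
    funext (noisyRuleStat_eq (α := α) (β := β) (ζ := ζ) hu hv y h0 h1)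
  rw [← heq] at hL hV
  have hI' : ∫ z, noisyRuleStat α β u v (cleanImage ζ u v y) W z ∂(jointLaw μ (q + 2) d) =
      α * (c₁ ^ 2 - c₂ ^ 2) * m₁ + α * c₂ ^ 2 := by rw [heq, hI, hm₁]
  have hvar : variance ζ μ = m₂ - m₁ ^ 2 := by rw [variance_eq_sub hζ, hm₁, hm₂]; rfl
  refine ⟨hL, integral_sub_const_sq hL _, ?_, ?_⟩
  · rw [ruleBias, hI', biasConst, ← hc₁, ← hc₂]
    congr 1
    ring
  · rw [ruleVariance, hV, hvar, norm_sq_add_single, norm_smul, norm_smul, hu, hv, varConst, ← hc₁,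
      ← hc₂, mul_one, mul_one, Real.norm_eq_abs, Real.norm_eq_abs, sq_abs, sq_abs]
    ring

end RuleStat

/-! ### Convergence on all patches and the theorem -/

/-- Off finitely many hyperplanes, gradient descent on the DDPM loss with a small step size converges
to a stationary point whose patches are top eigenvectors of the noisy second moment operators. -/
theorem exists_tendsto_gradDescent {Ω : Type*} [MeasurableSpace Ω] {μ : Measure Ω}
    [IsProbabilityMeasure μ] {P d : ℕ} {α β K : ℝ} [Nontrivial (Patch d)] {x₀ : Ω → Img P d}
    (hx : ∀ p, MemLp (fun ω => x₀ ω p) 2 μ) (hK : ∀ p, ∫ ω, ‖x₀ ω p‖ ^ 2 ∂μ ≤ K) :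
    ∃ e : Fin P → Patch d, (∀ p, e p ≠ 0) ∧ ∀ (R η : ℝ) (W₀ : Img P d),
      SmallStep β (α ^ 2 * K + β ^ 2) R η → ‖W₀‖ ^ 2 ≤ R → (∀ p, inner ℝ (e p) (W₀ p) ≠ 0) →
      ∃ (l : Fin P → ℝ) (W : Img P d),
        Tendsto (gradDescent (ddpmLoss μ x₀ α β) η W₀) atTop (𝓝 W) ∧
        HasGradientAt (ddpmLoss μ x₀ α β) 0 W ∧
        ∀ p, noisyMoment μ α β (fun ω => x₀ ω p) (W p) = l p • W p ∧
          ‖W p‖ ^ 2 = 1 / β ^ 2 + β / l p ∧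
          ∀ v, inner ℝ (noisyMoment μ α β (fun ω => x₀ ω p) v) v ≤ l p * ‖v‖ ^ 2 := by
  choose e he hconv using fun p => exists_tendsto_iterate_patchGrad
    (noisyMoment_isSymmetric μ α β fun ω => x₀ ω p) (le_noisyMoment_inner (α := α) (β := β) (hx p))
    (noisyMoment_inner_le (hx p) (hK p))
  refine ⟨e, he, fun R η W₀ hs hR hne => ?_⟩
  have hRp : ∀ p, ‖W₀ p‖ ^ 2 ≤ R := fun p =>
    (pow_le_pow_left₀ (norm_nonneg _) (PiLp.norm_apply_le W₀ p) 2).trans hR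
  choose l w hlim hM hn hl using fun p => hconv p R η (W₀ p) hs (hRp p) (hne p)
  have hβ := hs.beta_pos
  have hl0 : ∀ p, l p ≠ 0 := fun p => by
    obtain ⟨v, hv⟩ := exists_ne (0 : Patch d)
    have h1 := (le_noisyMoment_inner (α := α) (β := β) (hx p) v).trans (hl p v)
    have h2 : 0 < ‖v‖ ^ 2 := by positivity
    have h3 : 0 < β ^ 2 := by positivity
    intro h0
    rw [h0] at h1
    nlinarith
  refine ⟨l, WithLp.toLp 2 w, ?_, ?_, fun p => ⟨hM p, hn p, hl p⟩⟩
  · have h1 : Tendsto (fun k => (WithLp.toLp 2 fun p => gradDescent (ddpmLoss μ x₀ α β) η W₀ k p :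
        Img P d)) atTop (𝓝 (WithLp.toLp 2 w)) := by
      refine ((PiLp.continuous_toLp 2 _).tendsto w).comp (tendsto_pi_nhds.2 fun p => ?_)
      refine (hlim p).congr fun k => ?_
      rw [gradDescent_ddpmLoss hx]
    exact h1
  · have h1 := hasGradientAt_ddpmLoss (α := α) (β := β) hx (WithLp.toLp 2 w)
    have h2 : ∀ p, patchGrad β (noisyMoment μ α β fun ω => x₀ ω p) (w p) = 0 := fun p =>
      patchGrad_eq_zero hβ.ne' (hl0 p) (hM p) (hn p)
    simp only [h2] at h1
    exact h1

theorem mainTheorem1 (q : ℕ) (α β : ℝ) (hα : 0 < α) (hβ : 0 < β) (hβ' : β < 1)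
    (K C δ : ℝ) (hδ : 0 < δ) :
    ∃ η₀ : ℝ, 0 < η₀ ∧
      ∀ (d : ℕ) (e₁ e₂ : Patch d), ‖e₁‖ = 1 → ‖e₂‖ = 1 →
      ∀ (Ω : Type*) [MeasurableSpace Ω] (μ : Measure Ω) [IsProbabilityMeasure μ]
        (ζ : Ω → ℝ) (y : Ω → Fin q → Patch d),
        MemLp ζ 2 μ → (∀ j, MemLp (fun ω => y ω j) 2 μ) →
        (¬ ∀ᵐ ω ∂μ, ζ ω = 0) → (¬ ∀ᵐ ω ∂μ, ζ ω = 1) →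
        (∀ p, ∫ ω, ‖cleanImage ζ e₁ e₂ y ω p‖ ^ 2 ∂μ ≤ K) →
      ∀ (x₀ : Ω → Img (q + 2) d) (m₁ m₂ : ℝ),
        x₀ = cleanImage ζ e₁ e₂ y →
        m₁ = ∫ ω, ζ ω ∂μ → m₂ = ∫ ω, ζ ω ^ 2 ∂μ →
        -- the variance constant is positive
        0 < varConst m₁ m₂ α β ∧
        -- the bias constant is positive if `𝔼 ζ ∈ [0, 1]`, and its only zeros are the following
        (0 ≤ m₁ → m₁ ≤ 1 → 0 < biasConst m₁ m₂ α β) ∧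
        (biasConst m₁ m₂ α β = 0 ↔
          α ^ 2 * (variance ζ μ + m₁ * (1 - m₁)) + β ^ 2 = 0) ∧
        -- gradient descent from small Gaussian weights, up to an event of probability `δ`
        ∀ σ η : ℝ, 0 < σ → σ * √(d : ℝ) ≤ C → 0 < η → η ≤ η₀ →
          gaussianInit (q + 2) d σ
            {W₀ | ¬ ∃ W : Img (q + 2) d,
              Tendsto (gradDescent (ddpmLoss μ x₀ α β) η W₀)
                atTop (𝓝 W) ∧
              HasGradientAt (ddpmLoss μ x₀ α β) 0 W ∧
              ‖W 0‖ ^ 2 = statSq α β m₂ ∧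
              inner ℝ (W 0) e₁ ^ 2 = statSq α β m₂ ∧
              ‖W 1‖ ^ 2 = statSq α β (1 - 2 * m₁ + m₂) ∧
              inner ℝ (W 1) e₂ ^ 2 = statSq α β (1 - 2 * m₁ + m₂) ∧
              MemLp (noisyRuleStat α β e₁ e₂ x₀ W) 2
                (jointLaw μ (q + 2) d) ∧
              ruleMSE μ α β e₁ e₂ x₀ W =
                ruleBias μ α β e₁ e₂ x₀ W ^ 2 +
                  ruleVariance μ α β e₁ e₂ x₀ W ∧
              ruleBias μ α β e₁ e₂ x₀ W =
                biasConst m₁ m₂ α β ∧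
              ruleVariance μ α β e₁ e₂ x₀ W =
                varConst m₁ m₂ α β ∧
              ¬ ∀ᵐ z ∂(jointLaw μ (q + 2) d),
                noisyRuleStat α β e₁ e₂ x₀ W z = α / β ^ 2}
            ≤ ENNReal.ofReal δ := by
  -- The first entry is what `SmallStep` demands; the second makes the Markov bound `(q + 2) C² / R`
  -- at most `δ`. Neither involves `d` or the data.
  set R : ℝ := max (2 / β ^ 2) ((q + 2) * C ^ 2 / δ) with hR
  have hR0 : 0 < R := lt_max_of_lt_left (by positivity)
  -- `|K|` replaces `K` because no data are fixed yet and `K` could be negative.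
  obtain ⟨η₀, hη₀, hsmall⟩ := exists_smallStep (Λ := α ^ 2 * |K| + β ^ 2) hβ hβ'
    (by have : 0 ≤ α ^ 2 * |K| := by positivity
        linarith) (le_max_left _ _ : 2 / β ^ 2 ≤ R)
  refine ⟨η₀, hη₀, ?_⟩
  intro d e₁ e₂ he₁ he₂ Ω _ μ _ ζ y hζ hy hζ0 hζ1 hK x₀ m₁ m₂ hx₀ hm₁ hm₂
  subst hx₀
  have hζ' : MemLp (fun ω => 1 - ζ ω) 2 μ := (memLp_const 1).sub hζ
  have hvar : variance ζ μ = m₂ - m₁ ^ 2 := by rw [variance_eq_sub hζ, hm₁, hm₂]; rfl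
  have hm : ∫ ω, (1 - ζ ω) ^ 2 ∂μ = 1 - 2 * m₁ + m₂ := by
    have h1 : ∀ ω, (1 - ζ ω) ^ 2 = 1 - 2 * ζ ω + ζ ω ^ 2 := fun ω => by ring
    have hi := (hζ.integrable one_le_two).const_mul 2
    have hi' : Integrable (fun ω => 1 - 2 * ζ ω) μ := (integrable_const 1).sub hi
    simp_rw [h1]
    rw [integral_add hi' hζ.integrable_sq,
      integral_sub (integrable_const _) hi, integral_const_mul, ← hm₁, ← hm₂]
    simp
  have hp₁ : 0 < ∫ ω, ζ ω ^ 2 ∂μ := integral_sq_pos hζ hζ0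
  have hp₂ : 0 < ∫ ω, (1 - ζ ω) ^ 2 ∂μ := integral_sq_pos hζ' fun h => hζ1 <| by
    filter_upwards [h] with ω hω
    linarith
  have hm₂0 : 0 ≤ m₂ := hm₂ ▸ hp₁.le
  have hm0 : 0 ≤ 1 - 2 * m₁ + m₂ := hm ▸ hp₂.le
  have hvar0 : 0 ≤ m₂ - m₁ ^ 2 := hvar ▸ variance_nonneg ζ μ
  have hvc : 0 < varConst m₁ m₂ α β := varConst_pos hβ hm₂0 (by linarith) hm0
  have hbias := biasConst_eq_zero_iff hα hβ hm₂0 hm0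
  refine ⟨hvc, fun h0 h1 => ?_, by rw [hvar]; exact hbias, ?_⟩
  · refine lt_of_le_of_ne (abs_nonneg _) (Ne.symm fun h => ?_)
    have h2 := hbias.1 h
    have h3 : 0 ≤ m₁ * (1 - m₁) := mul_nonneg h0 (by linarith)
    have h4 : 0 ≤ α ^ 2 * (m₂ - m₁ ^ 2 + m₁ * (1 - m₁)) := by positivity
    have h5 : 0 < β ^ 2 := by positivity
    linarith
  intro σ η hσ hσC hη hηle
  have hnt : Nontrivial (Patch d) := ⟨e₁, 0, by rintro rfl; simp at he₁⟩
  have hx := memLp_cleanImage (μ := μ) hζ hy e₁ e₂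
  obtain ⟨e, he, hconv⟩ := exists_tendsto_gradDescent (α := α) (β := β) hx
    fun p => (hK p).trans (le_abs_self K)
  have hgood : ∀ W₀ : Img (q + 2) d, ‖W₀‖ ^ 2 ≤ R → (∀ p, inner ℝ (e p) (W₀ p) ≠ 0) → _ :=
    fun W₀ => hconv R η W₀ (hsmall η hη hηle)
  refine (measure_mono (t := {W₀ | R ≤ ‖W₀‖ ^ 2} ∪ ⋃ p, {W₀ | inner ℝ (e p) (W₀ p) = 0}) ?_).trans
    ((measure_union_le _ _).trans ?_)
  · intro W₀ hW₀
    by_contra hcon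
    simp only [Set.mem_union, Set.mem_ofPred_eq, Set.mem_iUnion, not_or, not_le, not_exists] at hcon
    refine hW₀ ?_
    obtain ⟨l, W, hlim, hgrad, hW⟩ := hgood W₀ hcon.1.le hcon.2
    obtain ⟨c₁, hW0, hc₁⟩ := exists_eq_smul_of_top_eigenvector hα hβ hζ he₁ hp₁ (hW 0).1 (hW 0).2.1
      (hW 0).2.2
    obtain ⟨c₂, hW1, hc₂⟩ := exists_eq_smul_of_top_eigenvector hα hβ hζ' he₂ hp₂ (hW 1).1
      (hW 1).2.1 (hW 1).2.2
    rw [← hm₂] at hc₁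
    rw [hm] at hc₂
    obtain ⟨hL, hmse, hb, hv⟩ := rule_errors hζ he₁ he₂ y hW0 hW1 hm₁ hm₂ hc₁ hc₂
    refine ⟨W, hlim, hgrad, ?_, ?_, ?_, ?_, hL, hmse, hb, hv, fun hae => ?_⟩
    · rw [hW0, norm_smul, he₁, mul_one, Real.norm_eq_abs, sq_abs, hc₁]
    · rw [hW0, inner_smul_left, real_inner_self_eq_norm_sq, he₁]; simpa using hc₁
    · rw [hW1, norm_smul, he₂, mul_one, Real.norm_eq_abs, sq_abs, hc₂]
    · rw [hW1, inner_smul_left, real_inner_self_eq_norm_sq, he₂]; simpa using hc₂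
    -- An almost surely constant statistic would have variance zero, against `0 < varConst`.
    · have h0 : ruleVariance μ α β e₁ e₂ (cleanImage ζ e₁ e₂ y) W = 0 := by
        rw [ruleVariance, variance_congr hae, variance_eq_integral aemeasurable_const]
        simp
      exact hvc.ne' (hv ▸ h0)
  · have hnull : gaussianInit (q + 2) d σ (⋃ p, {W₀ | inner ℝ (e p) (W₀ p) = 0}) = 0 :=
      measure_iUnion_null fun p => gaussianInit_hyperplane hσ.ne' p (he p)
    rw [hnull, add_zero]
    refine gaussianInit_norm_sq_ge hR0 ?_
    have h1 : (σ * √(d : ℝ)) ^ 2 ≤ C ^ 2 := pow_le_pow_left₀ (by positivity) hσC 2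
    rw [mul_pow, Real.sq_sqrt (Nat.cast_nonneg d)] at h1
    have h2 : (q + 2) * C ^ 2 ≤ δ * R := by
      have := le_max_right (2 / β ^ 2) ((q + 2) * C ^ 2 / δ)
      rw [div_le_iff₀ hδ] at this
      linarith
    push_cast
    nlinarith [Nat.cast_nonneg (α := ℝ) q]
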